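/- Let $\mathbb K$ be an algebraically closed field of characteristic zero and let $X$ be a normal affine toric variety, i.e. an irreducible normal affine variety over $\mathbb K$ with a regular action of a torus $T\cong(\mathbb K^\times)^n$ that has an open orbit. For a character $m$ of $T$ put $\mathbb K[X]_m=\{f : f(t\cdot x)=m(t)f(x)\}$; let $P$ be the monoid of all $m$ with $\mathbb K[X]_m\neq 0$, let $M=\mathbb ZP$ and $N=\mathrm{Hom}(M,\mathbb Z)$, let $\sigma^\vee\subset M_{\mathbb Q}$ be the cone spanned by $P$, and $\sigma\subset N_{\mathbb Q}$ its dual cone. For a ray $\rho$ of $\sigma$ let $p_\rho\in N$ be its primitive lattice vector. For a face $\tau$ of $\sigma^\vee$ let $O_\tau\subset X$ be the $T$-orbit whose vanishing ideal is $\bigoplus_{m\in P\setminus\tau}\mathbb K[X]_m$. A Demazure root is an $e\in M$ such that for some ray $\rho$ of $\sigma$ one has $\langle e,p_\rho\rangle=-1$ and $\langle e,p_{\rho'}\rangle\ge 0$ for all rays $\rho'\ne\rho$; it is a $\tau$-root if for some ray $\rho$ of $\sigma$ normal to $\tau$ one has $\langle e,p_\rho\rangle=-1$ and $\langle e,p_{\rho'}\rangle=0$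 for all other rays $\rho'$ normal to $\tau$. Let $\mathrm{Aut}(X)^0$ be the group of all automorphisms of $X$ that belong to an algebraic family $\{\varphi_b\}_{b\in B}$ of automorphisms (the map $B\times X\to X$, $(b,x)\mapsto\varphi_b(x)$, is a morphism) with $B$ an irreducible variety and $\varphi_{b_0}=\mathrm{id}_X$ for some $b_0\in B$. Then the closures of the $\mathrm{Aut}(X)^0$-orbits on $X$ are exactly the sets $\overline{O_\tau}$, where $\tau$ is a face of $\sigma^\vee$ that admits no $\tau$-roots: the closure of every $\mathrm{Aut}(X)^0$-orbit has this form for such a face $\tau$, and for every such face $\tau$ the set $\overline{O_\tau}$ is the closure of an $\mathrm{Aut}(X)^0$-orbit. -/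

import Mathlib

open CategoryTheory CategoryTheory.Limits AlgebraicGeometry TensorProduct

universe u

noncomputable section

namespace ToricOrbits

section NeutralComponent

variable {K : Type u} [Field K] {A : Type u} [CommRing A] [Algebra K A]

/-- `π : B ⟶ Spec K` is an irreducible algebraic variety over `K` (not necessarily affine):
an integral separated scheme of finite type. -/
structure IsIrreducibleVariety (K : Type u) [Field K] {B : Scheme.{u}}
    (π : B ⟶ Spec (.of K)) : Prop where
  integral : IsIntegral B
  separated : IsSeparated π
  locallyOfFiniteType : LocallyOfFiniteType π
  quasiCompact : QuasiCompact π

/-- The structure morphism `X ⟶ Spec K` of the affine scheme `X = Spec A`. -/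
abbrev strMap (K A : Type u) [Field K] [CommRing A] [Algebra K A] :
    Spec (.of A) ⟶ Spec (.of K) :=
  Spec.map (CommRingCat.ofHom (algebraMap K A))

/-- The automorphism of `X = Spec A` with comorphism `φ`. -/
abbrev specMap (φ : A ≃ₐ[K] A) : Spec (.of A) ⟶ Spec (.of A) :=
  Spec.map (CommRingCat.ofHom (φ : A →+* A))

/-- The member `φ_b : X ⟶ X`, `φ_b(x) = Φ(b, x)`, of a family `Φ : B × X ⟶ X` at a
`K`-point `b` of `B`. -/
def familyMember {B : Scheme.{u}} {π : B ⟶ Spec (.of K)}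
    (Φ : pullback π (strMap K A) ⟶ Spec (.of A))
    (b : Spec (.of K) ⟶ B) (hb : b ≫ π = 𝟙 _) : Spec (.of A) ⟶ Spec (.of A) :=
  pullback.lift (strMap K A ≫ b) (𝟙 _) (by rw [Category.assoc, hb]; simp) ≫ Φ

/-- `Φ : B × X ⟶ X` is an algebraic family of automorphisms of `X = Spec A`: a morphism over `K`
such that every member `φ_b` is an automorphism. -/
structure IsAlgebraicFamily {B : Scheme.{u}} (π : B ⟶ Spec (.of K))
    (Φ : pullback π (strMap K A) ⟶ Spec (.of A)) : Prop where
  comp_str : Φ ≫ strMap K A = pullback.fst π (strMap K A) ≫ π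
  isIso : ∀ (b : Spec (.of K) ⟶ B) (hb : b ≫ π = 𝟙 _), IsIso (familyMember Φ b hb)

/-- The automorphism of `X = Spec A` with comorphism `φ` may be included in an algebraic family
of automorphisms, with an irreducible variety as base, that contains the identity. -/
def InConnectedComponent (φ : A ≃ₐ[K] A) : Prop :=
  ∃ (B : Scheme.{u}) (π : B ⟶ Spec (.of K)) (Φ : pullback π (strMap K A) ⟶ Spec (.of A))
    (b₀ b₁ : Spec (.of K) ⟶ B) (h₀ : b₀ ≫ π = 𝟙 _) (h₁ : b₁ ≫ π = 𝟙 _),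
    IsIrreducibleVariety K π ∧ IsAlgebraicFamily π Φ ∧
      familyMember Φ b₀ h₀ = 𝟙 _ ∧ familyMember Φ b₁ h₁ = specMap φ

theorem specMap_one : specMap (1 : A ≃ₐ[K] A) = 𝟙 _ := Spec.map_id _

theorem specMap_mul (φ ψ : A ≃ₐ[K] A) : specMap (φ * ψ) = specMap φ ≫ specMap ψ := by
  rw [specMap, specMap, specMap, ← Spec.map_comp, ← CommRingCat.ofHom_comp]
  rfl

theorem specMap_strMap (φ : A ≃ₐ[K] A) : specMap φ ≫ strMap K A = strMap K A := by
  rw [specMap, strMap, ← Spec.map_comp, ← CommRingCat.ofHom_comp]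
  congr 2
  ext x
  exact φ.commutes x

theorem isIso_specMap (φ : A ≃ₐ[K] A) : IsIso (specMap φ) :=
  ⟨specMap φ⁻¹, by rw [← specMap_mul, mul_inv_cancel, specMap_one],
    by rw [← specMap_mul, inv_mul_cancel, specMap_one]⟩

theorem inConnectedComponent_one : InConnectedComponent (1 : A ≃ₐ[K] A) := by
  have key : ∀ (b : Spec (.of K) ⟶ Spec (.of K)) (hb : b ≫ 𝟙 _ = 𝟙 _),
      familyMember (A := A) (π := 𝟙 _) (pullback.snd _ _) b hb = 𝟙 _ :=
    fun b hb => pullback.lift_snd _ _ _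
  refine ⟨Spec (.of K), 𝟙 _, pullback.snd _ _, 𝟙 _, 𝟙 _, by simp, by simp,
    ⟨inferInstance, inferInstance, inferInstance, inferInstance⟩,
    ⟨pullback.condition.symm, fun b hb => ?_⟩, key _ _, ?_⟩
  · rw [key]; infer_instance
  · rw [key, specMap_one]

theorem inConnectedComponent_inv {φ : A ≃ₐ[K] A} (h : InConnectedComponent φ) : InConnectedComponent φ⁻¹ := by
  obtain ⟨B, π, Φ, b₀, b₁, h₀, h₁, hB, hΦ, e₀, e₁⟩ := h
  have := isIso_specMap φ⁻¹
  have e : ∀ b hb, familyMember (Φ ≫ specMap φ⁻¹) b hb = familyMember Φ b hb ≫ specMap φ⁻¹ :=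
    fun b hb => (Category.assoc _ _ _).symm
  refine ⟨B, π, Φ ≫ specMap φ⁻¹, b₁, b₀, h₁, h₀, hB, ⟨?_, fun b hb => ?_⟩, ?_, ?_⟩
  · rw [Category.assoc, specMap_strMap, hΦ.comp_str]
  · have := hΦ.isIso b hb
    rw [e]; infer_instance
  · rw [e, e₁, ← specMap_mul, mul_inv_cancel, specMap_one]
  · rw [e, e₀, Category.id_comp]

/-- `K`-points lift through a surjective closed immersion. -/
theorem exists_point_lift [IsAlgClosed K] {D P : Scheme.{u}} (ι : D ⟶ P) (π : P ⟶ Spec (.of K))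
    [LocallyOfFiniteType ι] [LocallyOfFiniteType π] (hι : IsClosedImmersion ι)
    (hs : Function.Surjective ι)
    (p : Spec (.of K) ⟶ P) (hp : p ≫ π = 𝟙 _) :
    ∃ d : Spec (.of K) ⟶ D, d ≫ ι = p := by
  set z := IsLocalRing.closedPoint K
  have hz : IsClosed {p z} := (pointEquivClosedPoint π ⟨p, hp⟩).2
  obtain ⟨y, hy⟩ := hs (p z)
  have hy' : IsClosed {y} := by
    have : {y} = ι ⁻¹' {p z} := by
      ext w
      simp only [Set.mem_singleton_iff, Set.mem_preimage]
      exact ⟨fun h => by rw [h, hy], fun h => ι.isClosedEmbedding.injective (h.trans hy.symm)⟩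
    rw [this]
    exact hz.preimage ι.continuous
  refine ⟨pointOfClosedPoint (ι ≫ π) y hy', ext_of_apply_closedPoint_eq π ?_ hp ?_⟩
  · rw [Category.assoc, pointOfClosedPoint_comp]
  · refine (Scheme.Hom.comp_apply _ _ _).trans ?_
    exact (congrArg ι (pointOfClosedPoint_apply (ι ≫ π) y hy' _)).trans hy

theorem isReduced_subscheme_nilradical (P : Scheme.{u}) : IsReduced P.nilradical.subscheme := by
  refine @IsReduced.of_openCover _ P.nilradical.subschemeCover.openCover fun i => ?_
  change IsReduced (Spec (.of (Γ(P, i.1) ⧸ P.nilradical.ideal i)))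
  have : _root_.IsReduced (Γ(P, i.1) ⧸ P.nilradical.ideal i) := by
    rw [← Ideal.isRadical_iff_quotient_reduced]
    exact Ideal.radical_isRadical _
  infer_instance

/-- Over an algebraically closed field the product of two irreducible schemes is irreducible. -/
theorem irreducibleSpace_pullback [IsAlgClosed K] {B C : Scheme.{u}} (π : B ⟶ Spec (.of K))
    (ξ : C ⟶ Spec (.of K)) (hB : IrreducibleSpace B) (hC : IrreducibleSpace C)
    [LocallyOfFiniteType ξ] :
    IrreducibleSpace (pullback π ξ : Scheme.{u}) := by
  have : IsIntegral (Spec (.of K)) := inferInstance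
  have : Subsingleton (Spec (.of K)) := inferInstance
  have : UniversallyOpen π := inferInstance
  have : JacobsonSpace C := LocallyOfFiniteType.jacobsonSpace ξ
  have key : ∀ U V : Set (pullback π ξ : Scheme.{u}), IsOpen U → IsOpen V → U.Nonempty →
      V.Nonempty → (U ∩ V).Nonempty := by
    intro U V hU hV neU neV
    have oU := (pullback.snd π ξ).isOpenMap U hU
    have oV := (pullback.snd π ξ).isOpenMap V hV
    have hne := nonempty_preirreducible_inter oU oV (neU.image _) (neV.image _)
    obtain ⟨c, ⟨⟨u, hu, huc⟩, ⟨v, hv, hvc⟩⟩, hc⟩ :=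
      nonempty_inter_closedPoints hne (oU.inter oV).isLocallyClosed
    set q := pointOfClosedPoint ξ c hc
    have hq : q ≫ ξ = 𝟙 _ := pointOfClosedPoint_comp ξ c hc
    set s : B ⟶ pullback π ξ := pullback.lift (𝟙 _) (π ≫ q) (by simp [hq])
    have hs : ∀ w : (pullback π ξ : Scheme.{u}), pullback.snd π ξ w = c → ∃ b, s b = w := by
      intro w hw
      have sq : IsPullback s π (pullback.snd π ξ) q := by
        refine IsPullback.of_right (h₁₂ := pullback.fst π ξ) (v₁₃ := π) (h₂₂ := ξ) ?_
          (pullback.lift_snd _ _ _) (IsPullback.of_hasPullback π ξ)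
        rw [pullback.lift_fst, hq]
        exact IsPullback.of_horiz_isIso ⟨by simp⟩
      have hr := Scheme.Pullback.range_fst (pullback.snd π ξ) q
      have hw' : w ∈ Set.range (pullback.fst (pullback.snd π ξ) q) := by
        rw [hr]
        exact ⟨IsLocalRing.closedPoint K, (pointOfClosedPoint_apply ξ c hc _).trans hw.symm⟩
      obtain ⟨b, hb⟩ := hw'
      refine ⟨sq.isoPullback.inv b, ?_⟩
      rw [← hb, ← sq.isoPullback_inv_fst]
      rfl
    obtain ⟨b₁, rfl⟩ := hs u huc
    obtain ⟨b₂, rfl⟩ := hs v hvc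
    obtain ⟨b, h1, h2⟩ := nonempty_preirreducible_inter (hU.preimage s.continuous)
      (hV.preimage s.continuous) ⟨b₁, hu⟩ ⟨b₂, hv⟩
    exact ⟨s b, h1, h2⟩
  have hne : Nonempty (pullback π ξ : Scheme.{u}) := inferInstance
  exact { isPreirreducible_univ := fun U V hU hV ⟨u, _, hu⟩ ⟨v, _, hv⟩ => by
            simpa using key U V hU hV ⟨u, hu⟩ ⟨v, hv⟩
          toNonempty := hne }

/-- The (reduced) product of two irreducible varieties. -/
theorem exists_variety_product [IsAlgClosed K] {B C : Scheme.{u}} {π : B ⟶ Spec (.of K)}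
    {ξ : C ⟶ Spec (.of K)} (hB : IsIrreducibleVariety K π) (hC : IsIrreducibleVariety K ξ) :
    ∃ (D : Scheme.{u}) (δ : D ⟶ Spec (.of K)) (p : D ⟶ B) (q : D ⟶ C),
      IsIrreducibleVariety K δ ∧ p ≫ π = δ ∧ q ≫ ξ = δ ∧
        ∀ (b : Spec (.of K) ⟶ B) (c : Spec (.of K) ⟶ C), b ≫ π = 𝟙 _ → c ≫ ξ = 𝟙 _ →
          ∃ d : Spec (.of K) ⟶ D, d ≫ p = b ∧ d ≫ q = c := by
  obtain ⟨_, _, _, _⟩ := hB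
  obtain ⟨_, _, _, _⟩ := hC
  have hP : IrreducibleSpace (pullback π ξ : Scheme.{u}) :=
    irreducibleSpace_pullback π ξ inferInstance inferInstance
  have hcond : pullback.snd π ξ ≫ ξ = pullback.fst π ξ ≫ π := pullback.condition.symm
  have hlift : ∀ (b : Spec (.of K) ⟶ B) (c : Spec (.of K) ⟶ C), b ≫ π = 𝟙 _ → c ≫ ξ = 𝟙 _ →
      ∃ d : Spec (.of K) ⟶ pullback π ξ, d ≫ pullback.fst π ξ = b ∧ d ≫ pullback.snd π ξ = c :=
    fun b c hb hc => ⟨pullback.lift b c (hb.trans hc.symm), pullback.lift_fst _ _ _,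
      pullback.lift_snd _ _ _⟩
  have i1 : IsSeparated (pullback.fst π ξ ≫ π) := inferInstance
  have i2 : LocallyOfFiniteType (pullback.fst π ξ ≫ π) := inferInstance
  have i3 : QuasiCompact (pullback.fst π ξ ≫ π) := inferInstance
  revert hP hcond hlift i1 i2 i3
  generalize pullback.fst π ξ = p
  generalize pullback.snd π ξ = q
  revert p q
  generalize pullback π ξ = P
  intro p q hP hcond hlift i1 i2 i3
  have hι : Function.Surjective P.nilradical.subschemeι := by
    rw [← Set.range_eq_univ]
    exact P.nilradical.range_subschemeι
  have hD : IrreducibleSpace P.nilradical.subscheme :=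
    Subtype.irreducibleSpace (s := (P.nilradical.support : Set P))
      (by rw [Scheme.support_nilradical]; exact IrreducibleSpace.isIrreducible_univ P)
  have hD' : IsIntegral P.nilradical.subscheme := by
    have := isReduced_subscheme_nilradical P
    exact isIntegral_of_irreducibleSpace_of_isReduced _
  refine ⟨P.nilradical.subscheme, P.nilradical.subschemeι ≫ p ≫ π,
    P.nilradical.subschemeι ≫ p, P.nilradical.subschemeι ≫ q,
    ⟨hD', inferInstance, inferInstance, inferInstance⟩, Category.assoc _ _ _,
    by rw [Category.assoc, hcond], fun b c hb hc => ?_⟩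
  obtain ⟨e, he1, he2⟩ := hlift b c hb hc
  obtain ⟨d, hd⟩ := exists_point_lift P.nilradical.subschemeι (p ≫ π) inferInstance hι e
    (by rw [← Category.assoc, he1, hb])
  exact ⟨d, by rw [← Category.assoc, hd, he1], by rw [← Category.assoc, hd, he2]⟩

/-- The composite of two algebraic families is an algebraic family over the product. -/
theorem exists_composite_family {B C D : Scheme.{u}} {π : B ⟶ Spec (.of K)}
    {ξ : C ⟶ Spec (.of K)} {δ : D ⟶ Spec (.of K)} {p : D ⟶ B} {q : D ⟶ C}
    (hp : p ≫ π = δ) (hq : q ≫ ξ = δ)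
    {Φ : pullback π (strMap K A) ⟶ Spec (.of A)} {Ψ : pullback ξ (strMap K A) ⟶ Spec (.of A)}
    (hΦ : IsAlgebraicFamily π Φ) (hΨ : IsAlgebraicFamily ξ Ψ) :
    ∃ Θ : pullback δ (strMap K A) ⟶ Spec (.of A), IsAlgebraicFamily δ Θ ∧
      ∀ (d : Spec (.of K) ⟶ D) (hd : d ≫ δ = 𝟙 _) (b : Spec (.of K) ⟶ B) (hb : b ≫ π = 𝟙 _)
        (c : Spec (.of K) ⟶ C) (hc : c ≫ ξ = 𝟙 _), d ≫ p = b → d ≫ q = c →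
          familyMember Θ d hd = familyMember Φ b hb ≫ familyMember Ψ c hc := by
  have c1 : (pullback.fst δ (strMap K A) ≫ p) ≫ π = pullback.snd δ (strMap K A) ≫ strMap K A := by
    rw [Category.assoc, hp, pullback.condition]
  obtain ⟨α, hα, hα'⟩ : ∃ α : pullback δ (strMap K A) ⟶ Spec (.of A),
      α ≫ strMap K A = pullback.fst _ _ ≫ δ ∧
      ∀ (d : Spec (.of K) ⟶ D) (hd : d ≫ δ = 𝟙 _) (b : Spec (.of K) ⟶ B) (hb : b ≫ π = 𝟙 _),
        d ≫ p = b → familyMember α d hd = familyMember Φ b hb := by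
    refine ⟨pullback.lift _ _ c1 ≫ Φ, ?_, ?_⟩
    · rw [Category.assoc, hΦ.comp_str, ← Category.assoc, pullback.lift_fst, Category.assoc, hp]
    · rintro d hd _ hb rfl
      rw [familyMember, familyMember, ← Category.assoc]
      congr 1
      apply pullback.hom_ext
      · rw [Category.assoc, pullback.lift_fst, ← Category.assoc, pullback.lift_fst,
          pullback.lift_fst, Category.assoc]
      · rw [Category.assoc, pullback.lift_snd, pullback.lift_snd, pullback.lift_snd]
  have c2 : (pullback.fst δ (strMap K A) ≫ q) ≫ ξ = α ≫ strMap K A := by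
    rw [Category.assoc, hq, hα]
  have hmem : ∀ (d : Spec (.of K) ⟶ D) (hd : d ≫ δ = 𝟙 _) (b : Spec (.of K) ⟶ B)
      (hb : b ≫ π = 𝟙 _) (c : Spec (.of K) ⟶ C) (hc : c ≫ ξ = 𝟙 _), d ≫ p = b → d ≫ q = c →
      familyMember (pullback.lift _ _ c2 ≫ Ψ) d hd =
        familyMember Φ b hb ≫ familyMember Ψ c hc := by
    rintro d hd _ hb _ hc rfl rfl
    have hs : familyMember α d hd ≫ strMap K A = strMap K A := by
      rw [familyMember, Category.assoc, hα, ← Category.assoc, pullback.lift_fst, Category.assoc,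
        hd, Category.comp_id]
    rw [← hα' d hd _ hb rfl]
    unfold familyMember at hs ⊢
    rw [← Category.assoc, ← Category.assoc]
    congr 1
    apply pullback.hom_ext
    · rw [Category.assoc, pullback.lift_fst, ← Category.assoc, pullback.lift_fst, Category.assoc,
        Category.assoc (W := Spec (.of A)), pullback.lift_fst, ← Category.assoc _ (strMap K A), hs]
    · rw [Category.assoc, pullback.lift_snd, Category.assoc, pullback.lift_snd, Category.comp_id]
  refine ⟨_, ⟨?_, fun d hd => ?_⟩, hmem⟩
  · rw [Category.assoc, hΨ.comp_str, ← Category.assoc, pullback.lift_fst, Category.assoc, hq]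
  · have hb : (d ≫ p) ≫ π = 𝟙 _ := by rw [Category.assoc, hp, hd]
    have hc : (d ≫ q) ≫ ξ = 𝟙 _ := by rw [Category.assoc, hq, hd]
    have := hΦ.isIso _ hb
    have := hΨ.isIso _ hc
    rw [hmem d hd _ hb _ hc rfl rfl]
    infer_instance

theorem inConnectedComponent_mul [IsAlgClosed K] {φ ψ : A ≃ₐ[K] A} (hφ : InConnectedComponent φ)
    (hψ : InConnectedComponent ψ) : InConnectedComponent (φ * ψ) := by
  obtain ⟨B, π, Φ, b₀, b₁, hb₀, hb₁, hB, hΦ, e₀, e₁⟩ := hφ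
  obtain ⟨C, ξ, Ψ, c₀, c₁, hc₀, hc₁, hC, hΨ, f₀, f₁⟩ := hψ
  obtain ⟨D, δ, p, q, hD, hp, hq, hpt⟩ := exists_variety_product hB hC
  obtain ⟨Θ, hΘ, hmem⟩ := exists_composite_family hp hq hΦ hΨ
  obtain ⟨d₀, hdb₀, hdc₀⟩ := hpt b₀ c₀ hb₀ hc₀
  obtain ⟨d₁, hdb₁, hdc₁⟩ := hpt b₁ c₁ hb₁ hc₁
  have k₀ : d₀ ≫ δ = 𝟙 _ := by rw [← hp, ← Category.assoc, hdb₀, hb₀]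
  have k₁ : d₁ ≫ δ = 𝟙 _ := by rw [← hp, ← Category.assoc, hdb₁, hb₁]
  refine ⟨D, δ, Θ, d₀, d₁, k₀, k₁, hD, hΘ, ?_, ?_⟩
  · rw [hmem d₀ k₀ b₀ hb₀ c₀ hc₀ hdb₀ hdc₀, e₀, f₀, Category.comp_id]
  · rw [hmem d₁ k₁ b₁ hb₁ c₁ hc₁ hdb₁ hdc₁, e₁, f₁, specMap_mul]

/-- The neutral component `Aut(X)⁰` of the automorphism group of the affine variety `X = Spec A`,
as a group of comorphisms, i.e. of `K`-algebra automorphisms of `A = K[X]`. -/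
def autZero (K A : Type u) [Field K] [IsAlgClosed K] [CommRing A] [Algebra K A] :
    Subgroup (A ≃ₐ[K] A) where
  carrier := {φ | InConnectedComponent φ}
  one_mem' := inConnectedComponent_one
  mul_mem' := inConnectedComponent_mul
  inv_mem' := inConnectedComponent_inv

end NeutralComponent

section Points

/-- The (closed) points of the affine variety with coordinate algebra `A`, over an algebraically
closed field `K`. -/
def Points (K A : Type*) [Field K] [CommRing A] [Algebra K A] : Type _ := A →ₐ[K] K

variable {K A : Type*} [Field K] [CommRing A] [Algebra K A]

/-- The value `f(x)` of a regular function `f` at a point `x`. -/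
def Points.eval (x : Points K A) (f : A) : K := (show A →ₐ[K] K from x) f

/-- The image of the point `x` under the automorphism with comorphism `φ`:
`f(φ(x)) = (φ^* f)(x)`. -/
def Points.map (φ : A ≃ₐ[K] A) (x : Points K A) : Points K A :=
  (show A →ₐ[K] K from x).comp (φ : A →ₐ[K] A)

/-- The maximal ideal of a point, as a point of the prime spectrum. -/
def Points.toPrimeSpectrum (x : Points K A) : PrimeSpectrum A :=
  ⟨RingHom.ker (show A →ₐ[K] K from x), RingHom.ker_isPrime _⟩

/-- The Zariski topology. -/
instance : TopologicalSpace (Points K A) :=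
  TopologicalSpace.induced Points.toPrimeSpectrum inferInstance

end Points

/-- The `Aut(X)⁰`-orbit of a point `x`. -/
def autZeroOrbit {K A : Type u} [Field K] [IsAlgClosed K] [CommRing A] [Algebra K A]
    (x : Points K A) : Set (Points K A) :=
  {y | ∃ φ ∈ autZero K A, y = x.map φ}

section Cones

variable {M : Type*} [AddCommGroup M]

/-- The cone `σ^∨` in `M_ℚ = ℚ ⊗ M` spanned by a subset `P` of the lattice `M`. -/
def weightCone (P : Set M) : PointedCone ℚ (ℚ ⊗[ℤ] M) :=
  PointedCone.hull ℚ ((fun m : M => (1 : ℚ) ⊗ₜ[ℤ] m) '' P)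

/-- The dual cone `σ` of `σ^∨`, in the dual space `N_ℚ` of `M_ℚ`. -/
def dualCone (P : Set M) : PointedCone ℚ (Module.Dual ℚ (ℚ ⊗[ℤ] M)) :=
  PointedCone.dual (Module.Dual.eval ℚ (ℚ ⊗[ℤ] M)) (weightCone P : Set (ℚ ⊗[ℤ] M))

/-- The inclusion of the dual lattice `N = Hom(M, ℤ)` in `N_ℚ`: the linear form `p` on `M`
extended to `M_ℚ`. -/
def latticeToDual (p : Module.Dual ℤ M) : Module.Dual ℚ (ℚ ⊗[ℤ] M) :=
  (TensorProduct.AlgebraTensorModule.rid ℤ ℚ ℚ).toLinearMap ∘ₗ LinearMap.baseChange ℚ p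

@[simp]
theorem latticeToDual_tmul (p : Module.Dual ℤ M) (q : ℚ) (m : M) :
    latticeToDual p (q ⊗ₜ[ℤ] m) = q * p m := by
  simp [latticeToDual, mul_comm]

/-- `p ∈ N` is the primitive lattice vector on a ray (a one-dimensional face) of `σ`. -/
structure IsPrimitiveRayVector (P : Set M) (p : Module.Dual ℤ M) : Prop where
  primitive : ∀ (k : ℤ) (q : Module.Dual ℤ M), p = k • q → IsUnit k
  isFaceOf : (PointedCone.hull ℚ {latticeToDual p}).IsFaceOf (dualCone P)

/-- `e` is a Demazure root of the cone `σ`, with distinguished ray spanned by `p`. -/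
def IsDemazureRootAt (P : Set M) (p : Module.Dual ℤ M) (e : M) : Prop :=
  IsPrimitiveRayVector P p ∧ p e = -1 ∧ ∀ p', IsPrimitiveRayVector P p' → p' ≠ p → 0 ≤ p' e

/-- `e` is a Demazure root of the cone `σ`. -/
def IsDemazureRoot (P : Set M) (e : M) : Prop := ∃ p, IsDemazureRootAt P p e

/-- The ray of `σ` spanned by `p` is normal to the face `τ` of `σ^∨`. -/
def IsNormalRay (P : Set M) (τ : PointedCone ℚ (ℚ ⊗[ℤ] M)) (p : Module.Dual ℤ M) : Prop :=
  IsPrimitiveRayVector P p ∧ ∀ v ∈ τ, latticeToDual p v = 0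

/-- `e` is a `τ`-root: a Demazure root whose pairing with the primitive vector of one of the rays
normal to `τ` is `-1` and with those of all other rays normal to `τ` is `0`. -/
def IsFaceRoot (P : Set M) (τ : PointedCone ℚ (ℚ ⊗[ℤ] M)) (e : M) : Prop :=
  IsDemazureRoot P e ∧
    ∃ p, IsNormalRay P τ p ∧ p e = -1 ∧ ∀ p', IsNormalRay P τ p' → p' ≠ p → p' e = 0

end Cones

section Torus

/-- The value `t^m` at `t ∈ T = (Kˣ)ⁿ` of the character `m ∈ ℤⁿ`. -/
def torusChar {K : Type*} [Field K] {n : ℕ} (m : Fin n → ℤ) (t : Fin n → Kˣ) : K :=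
  ((∏ i, t i ^ m i : Kˣ) : K)

/-- A regular action of the torus `T = (Kˣ)ⁿ` on the affine variety `X` with `K[X] = A`.
`comorphism t` is the comorphism of `x ↦ t · x`. The action map `T × X → X` is a morphism: for every
`f ∈ K[X]`, the function `(t, x) ↦ f(t · x)` lies in `K[T × X]`, that is, it has the form
`∑ m, t^m c_m(x)` with finitely many nonzero `c_m ∈ K[X]`. -/
structure TorusAction (K A : Type*) [Field K] [CommRing A] [Algebra K A] (n : ℕ) where
  comorphism : (Fin n → Kˣ) →* (A ≃ₐ[K] A)
  regular : ∀ f : A, ∃ c : (Fin n → ℤ) →₀ A, ∀ t : Fin n → Kˣ,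
    comorphism t f = c.sum fun m a => torusChar m t • a

namespace TorusAction

variable {K A : Type*} [Field K] [CommRing A] [Algebra K A] {n : ℕ} (T : TorusAction K A n)

/-- The torus orbit of a point. -/
def orbit (x : Points K A) : Set (Points K A) :=
  {y | ∃ t, y = x.map (T.comorphism t)}

/-- The homogeneous component `A_m` of weight `m`. -/
def weightSpace (m : Fin n → ℤ) : Submodule K A where
  carrier := {f | ∀ t, T.comorphism t f = torusChar m t • f}
  add_mem' {f g} hf hg t := by rw [map_add, hf t, hg t, smul_add]
  zero_mem' t := by rw [map_zero, smul_zero]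
  smul_mem' c f hf t := by rw [map_smul, hf t, smul_comm]

/-- The lattice `M`: the subgroup of the character group `ℤⁿ` generated by the weights of `A`.
It is the whole character group if the action is effective. -/
abbrev Lattice : Type := AddSubgroup.closure {m : Fin n → ℤ | T.weightSpace m ≠ ⊥}

/-- The weight monoid `P`, the set of all weights of `A`, as a subset of `M`. -/
def weights : Set T.Lattice := {m | T.weightSpace (m : Fin n → ℤ) ≠ ⊥}

/-- The cone `σ^∨` spanned by the weight monoid. -/
def cone : PointedCone ℚ (ℚ ⊗[ℤ] T.Lattice) := weightCone T.weights

/-- The subspace `I_τ`, the sum of all `A_m` with `m ∈ P \ τ`. -/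
def faceIdeal (τ : PointedCone ℚ (ℚ ⊗[ℤ] T.Lattice)) : Submodule K A :=
  ⨆ m ∈ {m : T.Lattice | m ∈ T.weights ∧ (1 : ℚ) ⊗ₜ[ℤ] m ∉ τ}, T.weightSpace (m : Fin n → ℤ)

/-- The torus orbit `O_τ` corresponding to a face `τ` of `σ^∨`: the orbit on which exactly the
functions in `I_τ` vanish. -/
def faceOrbit (τ : PointedCone ℚ (ℚ ⊗[ℤ] T.Lattice)) : Set (Points K A) :=
  {x | ∀ f : A, (∀ y ∈ T.orbit x, y.eval f = 0) ↔ f ∈ T.faceIdeal τ}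

end TorusAction

end Torus

end ToricOrbits

end

/-!
# Orbit closures of the neutral component of the automorphism group of an affine toric variety

Evaluation at a point of the open torus orbit identifies `A = K[X]` with the semigroup algebra of the
weight monoid `P` (`TorusAction.exists_algEquiv`); normality of `A` makes `P` saturated
(`mem_of_nsmul_mem`), so that `P` is cut out by the rays of `σ` (`mem_of_forall_ray_nonneg`). The
weights `m` with `χ^m(y) ≠ 0` form a face of `P`, the support of the point `y`; if this face spans
the face `τ` of `σ^∨`, then `y ∈ O_τ`.

If `τ` admits no roots, then `I_τ` is invariant under `Aut(X)⁰`. Indeed, a homogeneous component of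
degree `e` of a derivation has the form `χ^m ↦ l(m) χ^(m+e)` with `l` additive, and if it moves a
monomial from outside `τ` into `τ`, then `e` is a `τ`-root (`isFaceRoot_of_apply_ne_zero`); so `I_τ` is
stable under all derivations (`derivation_mem_ker_truncation`). An ideal that is stable under
derivations is stable under `Aut(X)⁰` (`apply_mem_of_mem_autZero`): near the identity, a member of a
family is given to every infinitesimal order by a unipotent automorphism, whose logarithm is a
derivation, and Krull's intersection theorem extends this to all members of the family. Since
`Aut(X)⁰` contains the torus (`comorphism_mem_autZero`), the orbit of a point of `O_τ` is dense in the
closure of `O_τ` (`closure_autZeroOrbit_eq`).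

If `τ` has a root `e`, then the root automorphism `χ^m ↦ χ^m (1 + χ^e) ^ p(m)` moves a point
whose support spans `τ` to a point with larger support (`exists_pointSupport_lt`). Hence a point with maximal
support in its `Aut(X)⁰`-orbit lies in `O_τ` for a face `τ` without roots. Conversely `O_τ` is
nonempty for every face: the truncation of functions to the monomials in `τ` is a homomorphism, and
its composite with a point of the open orbit is a point of `O_τ`.
-/

noncomputable section

namespace ToricOrbits

/-! ### Polyhedral cones -/

section PolyhedralCones

/-- Farkas' lemma. -/
theorem mem_hull_of_forall_dual_nonneg {V : Type*} [AddCommGroup V] [Module ℚ V] {ι : Type*}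
    (s : Finset ι) (g : ι → V) (b : V)
    (hb : ∀ f : Module.Dual ℚ V, (∀ i ∈ s, 0 ≤ f (g i)) → 0 ≤ f b) :
    b ∈ PointedCone.hull ℚ (g '' s) := by
  classical
  induction s using Finset.induction_on generalizing g b with
  | empty =>
    have : b = 0 := by
      rw [← Module.forall_dual_apply_eq_zero_iff ℚ b]
      intro f
      have h1 := hb f (by simp)
      have h2 := hb (-f) (by simp)
      simp only [LinearMap.neg_apply] at h2
      linarith
    rw [this]
    exact zero_mem _
  | insert a s ha ih =>
    by_cases hall : ∀ f : Module.Dual ℚ V, (∀ i ∈ s, 0 ≤ f (g i)) → 0 ≤ f b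
    · refine Submodule.span_mono (Set.image_mono ?_) (ih g b hall)
      simp
    push Not at hall
    obtain ⟨f, hf, hfb⟩ := hall
    have hfa : f (g a) < 0 := by
      by_contra h
      push Not at h
      refine absurd (hb f ?_) (not_le.mpr hfb)
      intro i hi
      rcases Finset.mem_insert.mp hi with rfl | hi
      exacts [h, hf i hi]
    -- Project along `g a` onto the kernel of `f`.
    set c : V → ℚ := fun v => f v / f (g a) with hc
    have key := ih (fun i => g i - c (g i) • g a) (b - c b • g a) (by
      intro h hh
      have := hb (h - (h (g a) / f (g a)) • f) (by
        intro i hi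
        rcases Finset.mem_insert.mp hi with rfl | hi
        · simp [hfa.ne]
        · have := hh i hi
          simp only [map_sub, map_smul, smul_eq_mul, hc] at this
          simp only [LinearMap.sub_apply, LinearMap.smul_apply, smul_eq_mul]
          linarith [show f (g i) / f (g a) * h (g a) = h (g a) / f (g a) * f (g i) by ring])
      simp only [LinearMap.sub_apply, LinearMap.smul_apply, smul_eq_mul] at this
      simp only [map_sub, map_smul, smul_eq_mul, hc]
      linarith [show f b / f (g a) * h (g a) = h (g a) / f (g a) * f b by ring])
    have main : ∀ v ∈ PointedCone.hull ℚ ((fun i => g i - c (g i) • g a) '' (s : Set ι)),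
        f v = 0 ∧ ∃ w ∈ PointedCone.hull ℚ (g '' (s : Set ι)), ∃ d : ℚ, 0 ≤ d ∧ v = w + d • g a := by
      intro v hv
      induction hv using Submodule.span_induction with
      | mem x hx =>
        obtain ⟨i, hi, rfl⟩ := hx
        refine ⟨by simp [hc, hfa.ne], g i, Submodule.subset_span ⟨i, hi, rfl⟩, - c (g i), ?_, ?_⟩
        · rw [neg_nonneg]
          exact div_nonpos_of_nonneg_of_nonpos (hf i hi) hfa.le
        · simp only [neg_smul, sub_eq_add_neg]
      | zero => exact ⟨by simp, 0, zero_mem _, 0, le_rfl, by simp⟩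
      | add x y _ _ hx hy =>
        obtain ⟨hx, w, hw, d, hd, rfl⟩ := hx
        obtain ⟨hy, w', hw', d', hd', rfl⟩ := hy
        exact ⟨by rw [map_add, hx, hy, add_zero], w + w', add_mem hw hw', d + d', add_nonneg hd hd',
          by rw [add_smul]; abel⟩
      | smul r x _ hx =>
        obtain ⟨hx, w, hw, d, hd, rfl⟩ := hx
        refine ⟨?_, r • w, Submodule.smul_mem _ _ hw, (r : ℚ) * d, mul_nonneg r.2 hd, ?_⟩
        · change f ((r : ℚ) • _) = 0
          rw [map_smul, hx, smul_zero]
        · change (r : ℚ) • (w + d • g a) = (r : ℚ) • w + _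
          rw [smul_add, mul_smul]
    obtain ⟨-, w, hw, d, hd, hwd⟩ := main _ key
    have hb' : b = w + (d + c b) • g a := by
      rw [add_smul, ← add_assoc, ← hwd, sub_add_cancel]
    rw [hb']
    refine add_mem (Submodule.span_mono (Set.image_mono (by simp)) hw) ?_
    refine PointedCone.smul_mem _ (add_nonneg hd ?_) (Submodule.subset_span ⟨a, by simp, rfl⟩)
    exact (div_pos_of_neg_of_neg hfb hfa).le

/-- A linear form that is nonnegative on the extremal vectors of a pointed polyhedral cone
is nonnegative on the whole cone. A vector `r` is extremal if the forms `g i` that vanish at `r` cut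
out the line of `r`. -/
theorem nonneg_of_nonneg_on_extremal {E : Type*} [AddCommGroup E] [Module ℚ E] {ι : Type*}
    [Fintype ι] (g : ι → Module.Dual ℚ E) (hg : ∀ x, (∀ i, g i x = 0) → x = 0)
    (F : Module.Dual ℚ E)
    (hF : ∀ r, r ≠ 0 → (∀ i, 0 ≤ g i r) →
      (∀ q, (∀ i, g i r = 0 → g i q = 0) → ∃ c : ℚ, q = c • r) → 0 ≤ F r)
    (x : E) (hx : ∀ i, 0 ≤ g i x) : 0 ≤ F x := by
  classical
  induction hn : (Finset.univ.filter fun i => g i x ≠ 0).card using Nat.strong_induction_on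
    generalizing x with
  | _ n ih =>
  have step : ∀ y, (∀ i, 0 ≤ g i y) → (∀ i, g i x = 0 → g i y = 0) →
      (∃ i, g i x ≠ 0 ∧ g i y = 0) → 0 ≤ F y := by
    rintro y hy hxy ⟨j, hj, hj'⟩
    refine ih _ ?_ y hy rfl
    rw [← hn]
    apply Finset.card_lt_card
    rw [Finset.ssubset_iff_of_subset]
    · exact ⟨j, by simpa using hj, by simpa using hj'⟩
    · intro i
      simp only [Finset.mem_filter, Finset.mem_univ, true_and]
      exact fun h h' => h (hxy i h')
  by_cases hx0 : x = 0
  · simp [hx0]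
  by_cases hext : ∀ q, (∀ i, g i x = 0 → g i q = 0) → ∃ c : ℚ, q = c • x
  · exact hF x hx0 hx hext
  push Not at hext
  obtain ⟨q, hq, hqx⟩ := hext
  have pos : ∀ y, y ≠ 0 → (∀ i, 0 ≤ g i y) → (Finset.univ.filter fun i => 0 < g i y).Nonempty := by
    intro y hy0 hy
    by_contra hne
    rw [Finset.not_nonempty_iff_eq_empty, Finset.filter_eq_empty_iff] at hne
    exact hy0 (hg y fun i => le_antisymm (not_lt.mp (hne (Finset.mem_univ i))) (hy i))
  -- Subtract from `q` the largest multiple of `x` that leaves it in the cone, and then from `x`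
  -- the largest multiple of the result.
  obtain ⟨i₀, hi₀, hmin⟩ := Finset.exists_min_image _ (fun i => g i q / g i x) (pos x hx0 hx)
  simp only [Finset.mem_filter, Finset.mem_univ, true_and] at hi₀ hmin
  set y := q - (g i₀ q / g i₀ x) • x with hy
  have hgy : ∀ i, g i y = g i q - g i₀ q / g i₀ x * g i x := fun i => by simp [hy]
  have hyx : ∀ i, g i x = 0 → g i y = 0 := fun i hi => by rw [hgy, hq i hi, hi]; ring
  have hy0 : y ≠ 0 := fun h => hqx _ (sub_eq_zero.mp h)
  have hypos : ∀ i, 0 ≤ g i y := by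
    intro i
    rcases (hx i).eq_or_lt with h | h
    · exact (hyx i h.symm).ge
    · have := hmin i h
      rw [le_div_iff₀ h] at this
      rw [hgy]
      linarith
  have hFy : 0 ≤ F y := step y hypos hyx ⟨i₀, hi₀.ne', by rw [hgy]; field_simp; ring⟩
  obtain ⟨i₁, hi₁, hmin₁⟩ := Finset.exists_min_image _ (fun i => g i x / g i y) (pos y hy0 hypos)
  simp only [Finset.mem_filter, Finset.mem_univ, true_and] at hi₁ hmin₁
  set t := g i₁ x / g i₁ y with ht
  have ht0 : 0 ≤ t := div_nonneg (hx i₁) (hypos i₁)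
  have hgz : ∀ i, g i (x - t • y) = g i x - t * g i y := fun i => by simp
  have hFz : 0 ≤ F (x - t • y) := by
    refine step _ (fun i => ?_) (fun i hi => by rw [hgz, hi, hyx i hi]; ring)
      ⟨i₁, fun h => hi₁.ne' (hyx _ h), by rw [hgz, ht]; field_simp; ring⟩
    rw [hgz]
    rcases (hypos i).eq_or_lt with h | h
    · rw [← h]; simpa using hx i
    · have := hmin₁ i h
      rw [le_div_iff₀ h] at this
      linarith
  have : F x = F (x - t • y) + t * F y := by simp
  rw [this]
  exact add_nonneg hFz (mul_nonneg ht0 hFy)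

end PolyhedralCones

/-! ### Rays and faces of lattice cones -/

section Lattice

variable {M : Type*} [AddCommGroup M]

theorem exists_nsmul_eq_tmul_of_mem_weightCone (S : AddSubmonoid M) {v : ℚ ⊗[ℤ] M}
    (hv : v ∈ weightCone (S : Set M)) : ∃ k : ℕ, 0 < k ∧ ∃ m ∈ S, k • v = (1 : ℚ) ⊗ₜ[ℤ] m := by
  induction hv using Submodule.span_induction with
  | mem x hx =>
    obtain ⟨m, hm, rfl⟩ := hx
    exact ⟨1, one_pos, m, hm, one_smul _ _⟩
  | zero => exact ⟨1, one_pos, 0, zero_mem _, by simp⟩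
  | add x y _ _ hx hy =>
    obtain ⟨k, hk, m, hm, h⟩ := hx
    obtain ⟨k', hk', m', hm', h'⟩ := hy
    refine ⟨k * k', mul_pos hk hk', k' • m + k • m',
      add_mem (nsmul_mem hm _) (nsmul_mem hm' _), ?_⟩
    rw [tmul_add, tmul_smul, tmul_smul, ← h, ← h', smul_add, smul_smul, smul_smul, mul_comm k k']
  | smul r x _ hx =>
    obtain ⟨k, hk, m, hm, h⟩ := hx
    refine ⟨k * (r : ℚ).den, mul_pos hk (Rat.den_pos _), (r : ℚ).num.toNat • m, nsmul_mem hm _, ?_⟩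
    rw [tmul_smul, ← h]
    change _ • (r : ℚ) • x = _
    rw [← Nat.cast_smul_eq_nsmul ℚ, ← Nat.cast_smul_eq_nsmul ℚ, ← Nat.cast_smul_eq_nsmul ℚ,
      smul_smul, smul_smul]
    congr 1
    have h1 : ((r : ℚ).num.toNat : ℚ) = (r : ℚ).num := by
      have : 0 ≤ (r : ℚ).num := Rat.num_nonneg.mpr r.2
      exact_mod_cast Int.toNat_of_nonneg this
    rw [h1]
    push_cast
    rw [mul_assoc, Rat.den_mul_eq_num]
    ring

theorem tmul_mem_weightCone {P : Set M} {m : M} (hm : m ∈ P) :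
    (1 : ℚ) ⊗ₜ[ℤ] m ∈ weightCone P :=
  Submodule.subset_span ⟨m, hm, rfl⟩

theorem mem_dualCone_iff {P : Set M} {x : Module.Dual ℚ (ℚ ⊗[ℤ] M)} :
    x ∈ dualCone P ↔ ∀ m ∈ P, 0 ≤ x ((1 : ℚ) ⊗ₜ[ℤ] m) := by
  constructor
  · intro h m hm
    exact h (tmul_mem_weightCone hm)
  · intro h v hv
    change 0 ≤ x v
    induction hv using Submodule.span_induction with
    | mem v hv => obtain ⟨m, hm, rfl⟩ := hv; exact h m hm
    | zero => simp
    | add v w _ _ hv hw => rw [map_add]; exact add_nonneg hv hw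
    | smul r v _ hv =>
      change 0 ≤ x ((r : ℚ) • v)
      rw [map_smul]
      exact mul_nonneg r.2 hv

theorem IsPrimitiveRayVector.nonneg {P : Set M} {p : Module.Dual ℤ M}
    (hp : IsPrimitiveRayVector P p) {m : M} (hm : m ∈ P) : 0 ≤ p m := by
  have h := mem_dualCone_iff.mp (hp.isFaceOf.le (Submodule.subset_span rfl)) m hm
  rw [latticeToDual_tmul] at h
  simpa using h

theorem IsPrimitiveRayVector.ne_zero {P : Set M} {p : Module.Dual ℤ M}
    (hp : IsPrimitiveRayVector P p) : p ≠ 0 := by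
  rintro rfl
  have := hp.primitive 2 0 (by simp)
  rw [Int.isUnit_iff] at this
  omega

/-- Every nonzero linear form on `M` is a positive multiple of a form with value `1`. -/
theorem exists_eq_smul_apply_eq_one {p : Module.Dual ℤ M} (hp : p ≠ 0) :
    ∃ (d : ℤ) (q : Module.Dual ℤ M), 0 < d ∧ p = d • q ∧ ∃ m, q m = 1 := by
  obtain ⟨d, hd⟩ := IsPrincipalIdealRing.principal (LinearMap.range p)
  have hdvd : ∀ m, |d| ∣ p m := fun m => by
    have : p m ∈ LinearMap.range p := ⟨m, rfl⟩
    rw [hd] at this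
    exact (abs_dvd _ _).mpr (Ideal.mem_span_singleton.mp this)
  have hd0 : |d| ≠ 0 := by
    intro h0
    exact hp (LinearMap.ext fun m => by simpa [h0] using hdvd m)
  choose q hq using hdvd
  refine ⟨|d|, { toFun := q
                 map_add' := fun x y => mul_left_cancel₀ hd0 (by
                  rw [← hq, map_add, hq, hq, mul_add])
                 map_smul' := fun c x => mul_left_cancel₀ hd0 (by
                  rw [← hq, map_smul, hq]; simp only [smul_eq_mul, RingHom.id_apply]; ring) },
    abs_pos.mpr (abs_ne_zero.mp hd0), LinearMap.ext fun m => hq m, ?_⟩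
  have : |d| ∈ LinearMap.range p := by
    rw [hd]
    exact Ideal.mem_span_singleton.mpr ((dvd_abs _ _).mpr dvd_rfl)
  obtain ⟨m, hm⟩ := this
  exact ⟨m, mul_left_cancel₀ hd0 (by rw [mul_one]; exact (hq m).symm.trans hm)⟩

theorem IsPrimitiveRayVector.exists_apply_eq_one {P : Set M} {p : Module.Dual ℤ M}
    (hp : IsPrimitiveRayVector P p) : ∃ m, p m = 1 := by
  obtain ⟨d, q, hd, hpq, m, hm⟩ := exists_eq_smul_apply_eq_one hp.ne_zero
  refine ⟨m, ?_⟩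
  rcases Int.isUnit_iff.mp (hp.primitive d q hpq) with rfl | rfl
  · rw [hpq, one_smul, hm]
  · omega

theorem mem_hull_singleton {E : Type*} [AddCommGroup E] [Module ℚ E] {x v : E} :
    v ∈ PointedCone.hull ℚ {x} ↔ ∃ c : ℚ, 0 ≤ c ∧ v = c • x := by
  rw [PointedCone.hull, Submodule.mem_span_singleton]
  constructor
  · rintro ⟨c, rfl⟩
    exact ⟨c, c.2, rfl⟩
  · rintro ⟨c, hc, rfl⟩
    exact ⟨⟨c, hc⟩, rfl⟩

theorem closure_eq_top_of_addSubmonoid_closure {P : AddSubmonoid M} {G : Finset M}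
    (hG : AddSubmonoid.closure (G : Set M) = P) (hgen : AddSubgroup.closure (P : Set M) = ⊤) :
    AddSubgroup.closure (G : Set M) = ⊤ := by
  rw [eq_top_iff, ← hgen, AddSubgroup.closure_le, ← hG]
  have h : AddSubmonoid.closure (G : Set M) ≤ (AddSubgroup.closure (G : Set M)).toAddSubmonoid :=
    AddSubmonoid.closure_le.mpr AddSubgroup.subset_closure
  exact h

theorem dual_ext_of_closure_eq_top {P : Set M} (hP : AddSubgroup.closure P = ⊤)
    {x : Module.Dual ℚ (ℚ ⊗[ℤ] M)} (hx : ∀ m ∈ P, x ((1 : ℚ) ⊗ₜ[ℤ] m) = 0) : x = 0 := by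
  have h : ∀ m : M, x ((1 : ℚ) ⊗ₜ[ℤ] m) = 0 := by
    intro m
    have hm : m ∈ AddSubgroup.closure P := by rw [hP]; trivial
    induction hm using AddSubgroup.closure_induction with
    | mem m hm => exact hx m hm
    | zero => simp
    | add a b _ _ ha hb => rw [tmul_add, map_add, ha, hb, add_zero]
    | neg a _ ha => rw [tmul_neg, map_neg, ha, neg_zero]
  ext m
  simpa using h m

theorem mem_dualCone_iff_of_closure {P : AddSubmonoid M} {G : Finset M}
    (hG : AddSubmonoid.closure (G : Set M) = P) {x : Module.Dual ℚ (ℚ ⊗[ℤ] M)} :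
    x ∈ dualCone (P : Set M) ↔ ∀ g ∈ G, 0 ≤ x ((1 : ℚ) ⊗ₜ[ℤ] g) := by
  rw [mem_dualCone_iff]
  refine ⟨fun h g hg => h g (hG ▸ AddSubmonoid.subset_closure hg), fun h m hm => ?_⟩
  rw [← hG] at hm
  induction hm using AddSubmonoid.closure_induction with
  | mem m hm => exact h m hm
  | zero => simp
  | add a b _ _ ha hb => rw [tmul_add, map_add]; exact add_nonneg ha hb

/-- The generators on the wall cut out by a ray of `σ` determine the line of the ray. -/
theorem IsPrimitiveRayVector.exists_eq_smul {P : AddSubmonoid M} {G : Finset M}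
    (hG : AddSubmonoid.closure (G : Set M) = P) {p : Module.Dual ℤ M}
    (hp : IsPrimitiveRayVector (P : Set M) p) {q : Module.Dual ℚ (ℚ ⊗[ℤ] M)}
    (hq : ∀ g ∈ G, p g = 0 → q ((1 : ℚ) ⊗ₜ[ℤ] g) = 0) : ∃ c : ℚ, q = c • latticeToDual p := by
  classical
  set N : ℚ := ∑ g ∈ G, |q ((1 : ℚ) ⊗ₜ[ℤ] g)| with hN
  have hN0 : 0 ≤ N := Finset.sum_nonneg fun _ _ => abs_nonneg _
  -- Both `N p + q` and `N p - q` lie in `σ`, and their sum lies on the ray.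
  have bound : ∀ g ∈ G, |q ((1 : ℚ) ⊗ₜ[ℤ] g)| ≤ N * p g := by
    intro g hg
    have h0 : 0 ≤ p g := hp.nonneg (hG ▸ AddSubmonoid.subset_closure hg)
    rcases h0.eq_or_lt with h | h
    · rw [hq g hg h.symm, ← h]; simp
    · have h1 : (1 : ℚ) ≤ p g := by exact_mod_cast h
      calc _ ≤ N := Finset.single_le_sum (f := fun g => |q ((1 : ℚ) ⊗ₜ[ℤ] g)|)
            (fun _ _ => abs_nonneg _) hg
        _ ≤ N * p g := le_mul_of_one_le_right hN0 h1
  have mem₁ : N • latticeToDual p + q ∈ dualCone (P : Set M) := by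
    rw [mem_dualCone_iff_of_closure hG]
    intro g hg
    have := (abs_le.mp (bound g hg)).1
    simp only [LinearMap.add_apply, LinearMap.smul_apply, latticeToDual_tmul, smul_eq_mul, one_mul]
    linarith
  have mem₂ : N • latticeToDual p - q ∈ dualCone (P : Set M) := by
    rw [mem_dualCone_iff_of_closure hG]
    intro g hg
    have := (abs_le.mp (bound g hg)).2
    simp only [LinearMap.sub_apply, LinearMap.smul_apply, latticeToDual_tmul, smul_eq_mul, one_mul]
    linarith
  have := hp.isFaceOf.mem_of_add_mem_left mem₁ mem₂ (mem_hull_singleton.mpr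
    ⟨2 * N, by positivity, by rw [mul_smul, two_smul]; abel⟩)
  obtain ⟨c, -, hc⟩ := mem_hull_singleton.mp this
  exact ⟨c - N, by rw [sub_smul, ← hc]; abel⟩

theorem IsPrimitiveRayVector.eq_of_eq_smul {P : AddSubmonoid M}
    (hgen : AddSubgroup.closure (P : Set M) = ⊤) {p p' : Module.Dual ℤ M}
    (hp : IsPrimitiveRayVector (P : Set M) p) (hp' : IsPrimitiveRayVector (P : Set M) p') {c : ℚ}
    (h : latticeToDual p' = c • latticeToDual p) : p' = p := by
  have hval : ∀ m, (p' m : ℚ) = c * p m := by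
    intro m
    simpa using congrArg (fun x => x ((1 : ℚ) ⊗ₜ[ℤ] m)) h
  obtain ⟨m, hm⟩ := hp.exists_apply_eq_one
  have hc : c = p' m := by rw [hval, hm]; simp
  have hpp : p' = p' m • p := by
    ext m'
    have := hval m'
    rw [hc] at this
    simpa using (by exact_mod_cast this : p' m' = p' m * p m')
  rcases Int.isUnit_iff.mp (hp'.primitive _ _ hpp) with h1 | h1
  · rw [hpp, h1, one_smul]
  · refine absurd ?_ hp.ne_zero
    have h0 : latticeToDual p = 0 := by
      refine dual_ext_of_closure_eq_top hgen fun m hm => ?_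
      have e1 := hp.nonneg hm
      have e2 := hp'.nonneg hm
      rw [hpp, h1] at e2
      simp only [LinearMap.smul_apply, smul_eq_mul] at e2
      rw [latticeToDual_tmul, show p m = 0 by omega]
      simp
    ext m
    simpa using congrArg (fun x => x ((1 : ℚ) ⊗ₜ[ℤ] m)) h0

theorem finite_setOf_isPrimitiveRayVector {P : AddSubmonoid M} (hP : P.FG)
    (hgen : AddSubgroup.closure (P : Set M) = ⊤) :
    {p : Module.Dual ℤ M | IsPrimitiveRayVector (P : Set M) p}.Finite := by
  classical
  obtain ⟨G, hG⟩ := hP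
  refine Set.Finite.of_finite_image (f := fun p => G.filter fun g => p g = 0)
    (G.powerset.finite_toSet.subset ?_) ?_
  · rintro _ ⟨p, -, rfl⟩
    exact Finset.mem_coe.mpr (Finset.mem_powerset.mpr (Finset.filter_subset _ _))
  · intro p hp p' hp' h
    obtain ⟨c, hc⟩ := IsPrimitiveRayVector.exists_eq_smul hG hp (q := latticeToDual p')
      (fun g hg hpg => by
        have : g ∈ G.filter fun g => p' g = 0 := by
          rw [← show (G.filter fun g => p g = 0) = G.filter fun g => p' g = 0 from h]
          simp [hg, hpg]
        rw [latticeToDual_tmul, (Finset.mem_filter.mp this).2]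
        simp)
    exact (IsPrimitiveRayVector.eq_of_eq_smul hgen hp hp' hc).symm

/-- The facet of `σ^∨` cut out by a ray of `σ` has a lattice point on no other wall. -/
theorem IsPrimitiveRayVector.exists_mem_facet {P : AddSubmonoid M} (hP : P.FG)
    (hgen : AddSubgroup.closure (P : Set M) = ⊤) {p : Module.Dual ℤ M}
    (hp : IsPrimitiveRayVector (P : Set M) p) :
    ∃ w ∈ P, p w = 0 ∧ ∀ p', IsPrimitiveRayVector (P : Set M) p' → p' ≠ p → 0 < p' w := by
  classical
  obtain ⟨G, hG⟩ := hP
  have hGP : ∀ g ∈ G, g ∈ P := fun g hg => hG ▸ AddSubmonoid.subset_closure hg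
  refine ⟨∑ g ∈ G with p g = 0, g, sum_mem fun g hg => hGP g (Finset.mem_filter.mp hg).1, ?_, ?_⟩
  · rw [map_sum]
    exact Finset.sum_eq_zero fun g hg => (Finset.mem_filter.mp hg).2
  · intro p' hp' hne
    rw [map_sum]
    refine Finset.sum_pos' (fun g hg => hp'.nonneg (hGP g (Finset.mem_filter.mp hg).1)) ?_
    by_contra! hcon
    obtain ⟨c, hc⟩ := hp.exists_eq_smul hG (q := latticeToDual p') (fun g hg hpg => by
      have h1 := hcon g (by simp [hg, hpg])
      have h2 := hp'.nonneg (hGP g hg)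
      rw [latticeToDual_tmul, le_antisymm h1 h2]
      simp)
    exact hne (hp.eq_of_eq_smul hgen hp' hc)

/-- A face of `σ^∨` has a lattice point on which all rays of `σ` not normal to the face are
positive. -/
theorem exists_mem_face_pos {P : AddSubmonoid M} (hP : P.FG)
    {τ : PointedCone ℚ (ℚ ⊗[ℤ] M)} (hτ : τ.IsFaceOf (weightCone (P : Set M))) :
    ∃ w ∈ P, (1 : ℚ) ⊗ₜ[ℤ] w ∈ τ ∧ ∀ p, IsPrimitiveRayVector (P : Set M) p →
      ¬ IsNormalRay (P : Set M) τ p → 0 < p w := by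
  classical
  obtain ⟨G, hG⟩ := hP
  have hGP : ∀ g ∈ G, g ∈ P := fun g hg => hG ▸ AddSubmonoid.subset_closure hg
  have hw : ∀ g ∈ G.filter (fun g => (1 : ℚ) ⊗ₜ[ℤ] g ∈ τ), g ∈ P :=
    fun g hg => hGP g (Finset.mem_filter.mp hg).1
  refine ⟨∑ g ∈ G with (1 : ℚ) ⊗ₜ[ℤ] g ∈ τ, g, sum_mem hw, ?_, ?_⟩
  · rw [tmul_sum]
    exact sum_mem fun g hg => (Finset.mem_filter.mp hg).2
  · intro p hp hnp
    rw [map_sum]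
    refine Finset.sum_pos' (fun g hg => hp.nonneg (hw g hg)) ?_
    by_contra! hcon
    refine hnp ⟨hp, fun v hv => ?_⟩
    have hlat : ∀ m ∈ P, (1 : ℚ) ⊗ₜ[ℤ] m ∈ τ → p m = 0 := by
      intro m hm
      rw [← hG] at hm
      induction hm using AddSubmonoid.closure_induction with
      | mem g hg =>
        exact fun h => le_antisymm (hcon g (Finset.mem_filter.mpr ⟨hg, h⟩)) (hp.nonneg (hGP g hg))
      | zero => simp
      | add a b ha hb iha ihb =>
        intro h
        rw [hG] at ha hb
        rw [tmul_add, hτ.add_mem_iff_mem (tmul_mem_weightCone ha) (tmul_mem_weightCone hb)] at h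
        rw [map_add, iha h.1, ihb h.2, add_zero]
    obtain ⟨k, hk, m, hm, h⟩ := exists_nsmul_eq_tmul_of_mem_weightCone P (hτ.le hv)
    have h0 : p m = 0 := hlat m hm (h ▸ nsmul_mem hv k)
    have h1 : k • latticeToDual p v = 0 := by rw [← map_nsmul, h, latticeToDual_tmul, h0]; simp
    exact (smul_eq_zero.mp h1).resolve_left hk.ne'

theorem tmul_one_injective [Module.Free ℤ M] :
    Function.Injective fun m : M => (1 : ℚ) ⊗ₜ[ℤ] m := by
  intro m m' h
  have b := Module.Free.chooseBasis ℤ M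
  refine b.ext_elem fun i => ?_
  have := congrArg (latticeToDual (b.coord i)) h
  simpa using this

theorem tmul_mem_weightCone_iff_of_face [Module.Free ℤ M] {P S : AddSubmonoid M}
    (hS : ∀ a ∈ P, ∀ b ∈ P, a + b ∈ S → a ∈ S) {m : M} (hm : m ∈ P) :
    (1 : ℚ) ⊗ₜ[ℤ] m ∈ weightCone (S : Set M) ↔ m ∈ S := by
  refine ⟨fun h => ?_, fun h => tmul_mem_weightCone h⟩
  obtain ⟨k, hk, m', hm', h'⟩ := exists_nsmul_eq_tmul_of_mem_weightCone S h
  rw [← tmul_smul] at h'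
  have h1 : k • m = m' := tmul_one_injective h'
  obtain ⟨k, rfl⟩ := Nat.exists_eq_succ_of_ne_zero hk.ne'
  refine hS m hm (k • m) (nsmul_mem hm k) ?_
  rw [← succ_nsmul', h1]
  exact hm'

theorem isFaceOf_weightCone [Module.Free ℤ M] {P S : AddSubmonoid M} (hSP : S ≤ P)
    (hS : ∀ a ∈ P, ∀ b ∈ P, a + b ∈ S → a ∈ S) :
    (weightCone (S : Set M)).IsFaceOf (weightCone (P : Set M)) := by
  refine ⟨Submodule.span_mono (Set.image_mono hSP), ?_⟩
  intro x y a hx hy ha hxy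
  obtain ⟨k, hk, m, hm, hkm⟩ := exists_nsmul_eq_tmul_of_mem_weightCone P
    (PointedCone.smul_mem _ ha.le hx)
  obtain ⟨l, hl, m', hm', hlm⟩ := exists_nsmul_eq_tmul_of_mem_weightCone P hy
  have h1 : (1 : ℚ) ⊗ₜ[ℤ] (l • m + k • m') ∈ weightCone (S : Set M) := by
    have := nsmul_mem hxy (l * k)
    rwa [smul_add, mul_smul, hkm, mul_comm, mul_smul, hlm, ← tmul_smul, ← tmul_smul,
      ← tmul_add] at this
  have h2 := (tmul_mem_weightCone_iff_of_face hS
    (add_mem (nsmul_mem hm l) (nsmul_mem hm' k))).mp h1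
  have h3 := tmul_mem_weightCone (hS _ (nsmul_mem hm l) _ (nsmul_mem hm' k) h2)
  rw [tmul_smul, ← hkm, smul_smul, ← Nat.cast_smul_eq_nsmul ℚ, smul_smul] at h3
  have hpos : 0 < ((l * k : ℕ) : ℚ) * a := mul_pos (by exact_mod_cast mul_pos hl hk) ha
  have := PointedCone.smul_mem _ (inv_nonneg.mpr hpos.le) h3
  rwa [smul_smul, inv_mul_cancel₀ hpos.ne', one_smul] at this

variable [Module.Free ℤ M] [Module.Finite ℤ M]

theorem exists_smul_latticeToDual_eq (x : Module.Dual ℚ (ℚ ⊗[ℤ] M)) :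
    ∃ (k : ℚ) (p : Module.Dual ℤ M), 0 < k ∧ x = k • latticeToDual p := by
  classical
  let b := Module.Free.chooseBasis ℤ M
  obtain ⟨k, hk⟩ := IsLocalization.exist_integer_multiples_of_finite (nonZeroDivisors ℤ)
    fun i => x ((1 : ℚ) ⊗ₜ[ℤ] b i)
  choose a ha using hk
  simp only [algebraMap_int_eq, eq_intCast] at ha
  have hk0 : (k : ℤ) ≠ 0 := nonZeroDivisors.coe_ne_zero k
  have hlin : (Int.castAddHom ℚ).toIntLinearMap ∘ₗ b.constr ℤ a =
      (k : ℤ) • (x.restrictScalars ℤ ∘ₗ TensorProduct.mk ℤ ℚ M 1) := by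
    refine b.ext fun i => ?_
    have h1 : b.constr ℤ a (b i) = a i := b.constr_basis ℤ a i
    have h2 := ha i
    rw [← h1] at h2
    exact h2
  have key : ((k : ℤ) : ℚ) • x = latticeToDual (b.constr ℤ a) := by
    ext m
    simpa using! (LinearMap.congr_fun hlin m).symm
  have hkQ : ((k : ℤ) : ℚ) ≠ 0 := Int.cast_ne_zero.mpr hk0
  rcases hk0.lt_or_gt with h | h
  · refine ⟨-((k : ℤ) : ℚ)⁻¹, -b.constr ℤ a, ?_, ?_⟩
    · rw [neg_pos, inv_lt_zero]
      exact_mod_cast h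
    · have hneg : latticeToDual (-b.constr ℤ a) = -latticeToDual (b.constr ℤ a) := by
        ext m; simp
      rw [hneg, smul_neg, neg_smul, neg_neg, ← key, smul_smul, inv_mul_cancel₀ hkQ, one_smul]
  · exact ⟨((k : ℤ) : ℚ)⁻¹, b.constr ℤ a, inv_pos.mpr (by exact_mod_cast h), by
      rw [← key, smul_smul, inv_mul_cancel₀ hkQ, one_smul]⟩

theorem exists_isPrimitiveRayVector {P : AddSubmonoid M} {G : Finset M}
    (hG : AddSubmonoid.closure (G : Set M) = P) (hgen : AddSubgroup.closure (P : Set M) = ⊤)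
    {r : Module.Dual ℚ (ℚ ⊗[ℤ] M)} (hr0 : r ≠ 0) (hr : r ∈ dualCone (P : Set M))
    (hext : ∀ q : Module.Dual ℚ (ℚ ⊗[ℤ] M), (∀ g ∈ G, r ((1 : ℚ) ⊗ₜ[ℤ] g) = 0 →
      q ((1 : ℚ) ⊗ₜ[ℤ] g) = 0) → ∃ c : ℚ, q = c • r) :
    ∃ (k : ℚ) (p : Module.Dual ℤ M), 0 < k ∧ r = k • latticeToDual p ∧
      IsPrimitiveRayVector (P : Set M) p := by
  obtain ⟨k, p', hk, rfl⟩ := exists_smul_latticeToDual_eq r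
  have hp' : p' ≠ 0 := by
    rintro rfl
    apply hr0
    ext m
    simp
  obtain ⟨d, p, hd, rfl, m₁, hm₁⟩ := exists_eq_smul_apply_eq_one hp'
  have hdQ : (0 : ℚ) < d := by exact_mod_cast hd
  have hdp : latticeToDual (d • p) = (d : ℚ) • latticeToDual p := by
    ext m
    simp
  rw [hdp, smul_smul] at hr hext hr0 ⊢
  set c := k * (d : ℚ) with hc
  have hc0 : 0 < c := mul_pos hk hdQ
  refine ⟨c, p, hc0, rfl, ?_, ?_⟩
  · intro a q hq
    refine IsUnit.of_mul_eq_one (q m₁) ?_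
    rw [← hm₁, hq]
    simp
  · have hp : latticeToDual p ∈ dualCone (P : Set M) := by
      have := PointedCone.smul_mem _ (inv_nonneg.mpr hc0.le) hr
      rwa [smul_smul, inv_mul_cancel₀ hc0.ne', one_smul] at this
    refine ⟨?_, ?_⟩
    · rw [PointedCone.hull, Submodule.span_singleton_le_iff_mem]
      exact hp
    · intro x y a hx hy ha hxy
      obtain ⟨b, hb, hxy⟩ := mem_hull_singleton.mp hxy
      rw [mem_dualCone_iff_of_closure hG] at hx hy
      obtain ⟨s, hs⟩ := hext x fun g hg hgr => by
        have h1 := congrArg (fun z => z ((1 : ℚ) ⊗ₜ[ℤ] g)) hxy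
        have h2 := hx g hg
        have h3 := hy g hg
        simp only [LinearMap.add_apply, LinearMap.smul_apply, smul_eq_mul] at h1 hgr
        rcases mul_eq_zero.mp hgr with h | h
        · exact absurd h hc0.ne'
        · rw [h, mul_zero] at h1
          have h4 : a * x ((1 : ℚ) ⊗ₜ[ℤ] g) = 0 := by nlinarith [mul_nonneg ha.le h2]
          exact (mul_eq_zero.mp h4).resolve_left ha.ne'
      refine mem_hull_singleton.mpr ⟨s * c, ?_, by rw [hs, smul_smul]⟩
      -- Some generator is positive on the ray, and `x` is nonnegative there.
      obtain ⟨g, hg, hpg⟩ : ∃ g ∈ G, 0 < latticeToDual p ((1 : ℚ) ⊗ₜ[ℤ] g) := by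
        by_contra! hcon
        apply hr0
        suffices latticeToDual p = 0 by rw [this, smul_zero]
        refine dual_ext_of_closure_eq_top (P := (G : Set M))
          (closure_eq_top_of_addSubmonoid_closure hG hgen) fun g hg =>
          le_antisymm (hcon g hg) ((mem_dualCone_iff_of_closure hG).mp hp g hg)
      have := hx g hg
      rw [hs] at this
      simp only [LinearMap.smul_apply, smul_eq_mul] at this
      rw [← mul_assoc] at this
      exact nonneg_of_mul_nonneg_left this hpg

/-- In a saturated monoid the inequalities given by the rays of `σ` define `P`. -/
theorem mem_of_forall_ray_nonneg {P : AddSubmonoid M} (hP : P.FG)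
    (hgen : AddSubgroup.closure (P : Set M) = ⊤)
    (hsat : ∀ (m : M) (k : ℕ), 0 < k → k • m ∈ P → m ∈ P) {m : M}
    (hm : ∀ p, IsPrimitiveRayVector (P : Set M) p → 0 ≤ p m) : m ∈ P := by
  obtain ⟨G, hG⟩ := hP
  have hGP : ∀ g ∈ G, g ∈ P := fun g hg => hG ▸ AddSubmonoid.subset_closure hg
  have h1 : (1 : ℚ) ⊗ₜ[ℤ] m ∈ weightCone (P : Set M) := by
    have := mem_hull_of_forall_dual_nonneg G (fun g => (1 : ℚ) ⊗ₜ[ℤ] g) ((1 : ℚ) ⊗ₜ[ℤ] m) (by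
      intro f hf
      refine nonneg_of_nonneg_on_extremal (ι := G)
        (fun g => Module.Dual.eval ℚ (ℚ ⊗[ℤ] M) ((1 : ℚ) ⊗ₜ[ℤ] g.1)) ?_
        (Module.Dual.eval ℚ (ℚ ⊗[ℤ] M) ((1 : ℚ) ⊗ₜ[ℤ] m)) ?_ f (fun i => hf i.1 i.2)
      · intro x hx
        exact dual_ext_of_closure_eq_top (closure_eq_top_of_addSubmonoid_closure hG hgen)
          fun g hg => hx ⟨g, hg⟩
      · intro r hr0 hr hext
        obtain ⟨k, p, hk, hrp, hp⟩ := exists_isPrimitiveRayVector hG hgen hr0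
          ((mem_dualCone_iff_of_closure hG).mpr fun g hg => hr ⟨g, hg⟩)
          (fun q hq => hext q fun i hi => hq i.1 i.2 hi)
        change 0 ≤ r _
        rw [hrp, LinearMap.smul_apply, latticeToDual_tmul, one_mul]
        exact mul_nonneg hk.le (by exact_mod_cast hm p hp))
    exact Submodule.span_mono (Set.image_mono hGP) this
  obtain ⟨k, hk, m', hm', h⟩ := exists_nsmul_eq_tmul_of_mem_weightCone P h1
  rw [← tmul_smul] at h
  exact hsat m k hk (tmul_one_injective h ▸ hm')

/-- If all rays of `σ` that are negative on `m` are positive on `w`, then adding to `m` a large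
multiple of `w` yields an element of `P`. Here `s` holds for the rays that are nonnegative on `m`. -/
theorem exists_add_nsmul_mem {P : AddSubmonoid M} (hP : P.FG)
    (hgen : AddSubgroup.closure (P : Set M) = ⊤)
    (hsat : ∀ (m : M) (k : ℕ), 0 < k → k • m ∈ P → m ∈ P) {s : Module.Dual ℤ M → Prop} {w m : M}
    (hw : w ∈ P) (hws : ∀ p, IsPrimitiveRayVector (P : Set M) p → ¬ s p → 0 < p w)
    (hm : ∀ p, IsPrimitiveRayVector (P : Set M) p → s p → 0 ≤ p m) :
    ∃ N : ℕ, m + N • w ∈ P := by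
  obtain ⟨N, hN⟩ := ((finite_setOf_isPrimitiveRayVector hP hgen).image
    fun p : Module.Dual ℤ M => (-p m).toNat).bddAbove
  refine ⟨N, mem_of_forall_ray_nonneg hP hgen hsat fun p hp => ?_⟩
  rw [map_add, map_nsmul, nsmul_eq_mul]
  by_cases hn : s p
  · exact add_nonneg (hm p hp hn) (mul_nonneg (by positivity) (hp.nonneg hw))
  · have h1 := hws p hp hn
    have h2 : (-p m).toNat ≤ N := hN ⟨p, hp, rfl⟩
    have h3 : (N : ℤ) ≤ N * p w := le_mul_of_one_le_right (by positivity) h1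
    omega

/-- The rays of `σ` normal to a face `τ` of `σ^∨` cut out the lattice points of `τ`. -/
theorem tmul_mem_face_of_forall_normal {P : AddSubmonoid M} (hP : P.FG)
    (hgen : AddSubgroup.closure (P : Set M) = ⊤)
    (hsat : ∀ (m : M) (k : ℕ), 0 < k → k • m ∈ P → m ∈ P)
    {τ : PointedCone ℚ (ℚ ⊗[ℤ] M)} (hτ : τ.IsFaceOf (weightCone (P : Set M))) {m : M} (hm : m ∈ P)
    (h : ∀ p, IsNormalRay (P : Set M) τ p → p m = 0) : (1 : ℚ) ⊗ₜ[ℤ] m ∈ τ := by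
  obtain ⟨w, hwP, hwτ, hw⟩ := exists_mem_face_pos hP hτ
  obtain ⟨N, hmem⟩ := exists_add_nsmul_mem hP hgen hsat (m := -m) hwP hw
    fun p _ hn => by rw [map_neg, h p hn, neg_zero]
  refine hτ.mem_of_add_mem_left (tmul_mem_weightCone hm) (tmul_mem_weightCone hmem) ?_
  rw [← tmul_add, add_neg_cancel_left, tmul_smul]
  exact nsmul_mem hwτ N

end Lattice

/-! ### Demazure roots and roots of faces -/

section Roots

variable {M : Type*} [AddCommGroup M] [Module.Free ℤ M] [Module.Finite ℤ M] {P : AddSubmonoid M}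

theorem IsDemazureRootAt.add_mem (hP : P.FG) (hgen : AddSubgroup.closure (P : Set M) = ⊤)
    (hsat : ∀ (m : M) (k : ℕ), 0 < k → k • m ∈ P → m ∈ P) {p : Module.Dual ℤ M} {e : M}
    (he : IsDemazureRootAt (P : Set M) p e) {m : M} (hm : m ∈ P) (hpm : 0 < p m) : m + e ∈ P := by
  refine mem_of_forall_ray_nonneg hP hgen hsat fun p' hp' => ?_
  rw [map_add]
  by_cases h : p' = p
  · rw [h, he.2.1]; omega
  · exact add_nonneg (hp'.nonneg hm) (he.2.2 p' hp' h)

/-- A `τ`-root moves some lattice point of `σ^∨` outside `τ`, at height one over the distinguished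
facet, into `τ`. -/
theorem IsFaceRoot.exists_add_mem_face (hP : P.FG) (hgen : AddSubgroup.closure (P : Set M) = ⊤)
    (hsat : ∀ (m : M) (k : ℕ), 0 < k → k • m ∈ P → m ∈ P) {τ : PointedCone ℚ (ℚ ⊗[ℤ] M)}
    (hτ : τ.IsFaceOf (weightCone (P : Set M))) {e : M} (he : IsFaceRoot (P : Set M) τ e) :
    ∃ p, IsDemazureRootAt (P : Set M) p e ∧ IsNormalRay (P : Set M) τ p ∧
      ∃ m ∈ P, p m = 1 ∧ m + e ∈ P ∧ (1 : ℚ) ⊗ₜ[ℤ] (m + e) ∈ τ := by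
  obtain ⟨⟨p₀, hp₀⟩, p, hn, hpe, hother⟩ := he
  obtain rfl : p = p₀ := by
    by_contra hne
    have := hp₀.2.2 p hn.1 hne
    omega
  obtain ⟨w, hwP, hwτ, hw⟩ := exists_mem_face_pos hP hτ
  obtain ⟨N, hN⟩ := exists_add_nsmul_mem hP hgen hsat (m := -e) hwP hw fun p' _ hn' => by
    rw [map_neg]
    by_cases h : p' = p
    · rw [h, hpe]; omega
    · rw [hother p' hn' h, neg_zero]
  have hpw : p w = 0 := by simpa using hn.2 _ hwτ
  refine ⟨p, hp₀, hn, -e + N • w, hN, ?_, ?_⟩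
  · rw [map_add, map_neg, map_nsmul, hpe, hpw]; simp
  · rw [add_right_comm, neg_add_cancel, zero_add]
    refine ⟨nsmul_mem hwP N, ?_⟩
    rw [tmul_smul]
    exact nsmul_mem hwτ N

/-- The map `χ^m ↦ l(m) χ^(m+e)` given by an additive function `l` is a homogeneous derivation of
the semigroup algebra. If it does not preserve the ideal of a face `τ`, then `e` is a `τ`-root. -/
theorem isFaceRoot_of_apply_ne_zero {K : Type*} [Field K] [CharZero K] (hP : P.FG)
    (hgen : AddSubgroup.closure (P : Set M) = ⊤)
    (hsat : ∀ (m : M) (k : ℕ), 0 < k → k • m ∈ P → m ∈ P) {τ : PointedCone ℚ (ℚ ⊗[ℤ] M)}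
    (hτ : τ.IsFaceOf (weightCone (P : Set M))) {e : M} (l : P →+ K)
    (hl : ∀ m : P, l m ≠ 0 → (m : M) + e ∈ P) {m : P} (hm : (1 : ℚ) ⊗ₜ[ℤ] (m : M) ∉ τ)
    (hme : (1 : ℚ) ⊗ₜ[ℤ] ((m : M) + e) ∈ τ) (hlm : l m ≠ 0) : IsFaceRoot (P : Set M) τ e := by
  have vanish : ∀ p, IsPrimitiveRayVector (P : Set M) p → ∀ a : P, p a + p e < 0 → l a = 0 := by
    intro p hp a ha
    by_contra h
    have := hp.nonneg (hl a h)
    rw [map_add] at this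
    omega
  -- If `l` is supported on the half-space `p ≥ 1`, then `l` is a multiple of `p`.
  have level : ∀ p, IsPrimitiveRayVector (P : Set M) p → p e < 0 → ∀ a b : P,
      p a = p b → l a = l b := by
    intro p hp hpe a b hab
    obtain ⟨w, hwP, hpw, hw⟩ := hp.exists_mem_facet hP hgen
    obtain ⟨N, hN⟩ := exists_add_nsmul_mem hP hgen hsat (m := (a : M) - b) (s := fun p' => p' = p)
      hwP hw (fun p' _ h => by rw [h, map_sub, hab, sub_self])
    have e1 : a + N • (⟨w, hwP⟩ : P) = b + ⟨_, hN⟩ := by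
      ext
      simp only [AddSubmonoid.coe_add, AddSubmonoidClass.coe_nsmul]
      abel
    have e2 := congrArg l e1
    rw [map_add, map_add, map_nsmul, vanish p hp ⟨w, hwP⟩ (by simp [hpw, hpe]),
      vanish p hp ⟨_, hN⟩ (by
        simp only [map_add, map_sub, map_nsmul, hpw, hab, sub_self, smul_zero, add_zero, zero_add]
        exact hpe)] at e2
    simpa using e2
  obtain ⟨p, hn, hpm⟩ : ∃ p, IsNormalRay (P : Set M) τ p ∧ p m ≠ 0 := by
    by_contra! h
    exact hm (tmul_mem_face_of_forall_normal hP hgen hsat hτ m.2 h)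
  have hnormal : ∀ p', IsNormalRay (P : Set M) τ p' → p' m + p' e = 0 := by
    intro p' hn'
    have := hn'.2 _ hme
    rw [latticeToDual_tmul, one_mul, map_add] at this
    exact_mod_cast this
  have hp := hn.1
  have hpm0 : 0 < p m := lt_of_le_of_ne (hp.nonneg m.2) (Ne.symm hpm)
  have hpe0 : p e < 0 := by have := hnormal p hn; omega
  obtain ⟨m₁, hm₁⟩ : ∃ m₁ : P, p m₁ = 1 := by
    obtain ⟨m₀, hm₀⟩ := hp.exists_apply_eq_one
    obtain ⟨w, hwP, hpw, hw⟩ := hp.exists_mem_facet hP hgen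
    obtain ⟨N, hN⟩ := exists_add_nsmul_mem hP hgen hsat (m := m₀) (s := fun p' => p' = p)
      hwP hw (fun p' _ h => by rw [h, hm₀]; exact zero_le_one)
    exact ⟨⟨_, hN⟩, by simp [hpw, hm₀]⟩
  have hmul : ∀ a : P, l a = (p a).toNat • l m₁ := by
    intro a
    rw [← map_nsmul]
    refine level p hp hpe0 _ _ ?_
    have := hp.nonneg a.2
    rw [AddSubmonoidClass.coe_nsmul, map_nsmul, hm₁, nsmul_eq_mul]
    omega
  have hlm₁ : l m₁ ≠ 0 := fun h => hlm (by rw [hmul, h, smul_zero])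
  have hpe : p e = -1 := by
    by_contra h
    exact hlm₁ (vanish p hp m₁ (by omega))
  have hroot : IsDemazureRootAt (P : Set M) p e := by
    refine ⟨hp, hpe, fun p' hp' hne => ?_⟩
    by_contra! h
    obtain ⟨w, hwP, hpw, hw⟩ := hp'.exists_mem_facet hP hgen
    have h1 := hmul ⟨w, hwP⟩
    rw [vanish p' hp' ⟨w, hwP⟩ (by simpa [hpw] using h), eq_comm, smul_eq_zero] at h1
    have h2 := hw p hp hne.symm
    rcases h1 with h1 | h1
    · simp only at h1
      omega
    · exact hlm₁ h1
  refine ⟨⟨p, hroot⟩, p, hn, hpe, fun p' hn' hne => ?_⟩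
  have h1 := hnormal p' hn'
  have h2 := hn'.1.nonneg m.2
  have h3 := hroot.2.2 p' hn'.1 hne
  omega

end Roots

/-! ### Unipotent endomorphisms and derivations -/

section Unipotent

open Polynomial in
/-- Over a `ℚ`-algebra, which may have zero divisors, a polynomial is determined by its values at
the natural numbers. -/
theorem polynomial_eq_of_eval_natCast_eq {C : Type*} [CommRing C] [Algebra ℚ C] {p q : C[X]}
    (h : ∀ s : ℕ, p.eval (s : C) = q.eval (s : C)) : p = q := by
  rw [← sub_eq_zero]
  set d := p - q with hd
  have hd0 : ∀ s : ℕ, d.eval (s : C) = 0 := fun s => by rw [hd, eval_sub, h, sub_self]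
  ext j
  rw [coeff_zero, ← Module.forall_dual_apply_eq_zero_iff ℚ]
  intro l
  set r : ℚ[X] := ∑ i ∈ Finset.range (d.natDegree + 1), monomial i (l (d.coeff i)) with hr
  have hr0 : r = 0 := by
    refine eq_zero_of_infinite_isRoot r
      ((Set.infinite_range_of_injective (Nat.cast_injective (R := ℚ))).mono ?_)
    rintro _ ⟨s, rfl⟩
    have h1 := congrArg l (hd0 s)
    rw [eval_eq_sum_range, map_sum, map_zero] at h1
    change r.eval (s : ℚ) = 0
    rw [hr, eval_finsetSum, ← h1]
    refine Finset.sum_congr rfl fun i _ => ?_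
    have h2 : d.coeff i * (s : C) ^ i = ((s : ℚ) ^ i) • d.coeff i := by
      rw [Algebra.smul_def, mul_comm]
      simp
    rw [eval_monomial, h2, map_smul, smul_eq_mul, mul_comm]
  by_cases hj : j < d.natDegree + 1
  · have h3 := congrArg (fun r => coeff r j) hr0
    simp only [hr, finsetSum_coeff, coeff_monomial, coeff_zero] at h3
    rw [Finset.sum_eq_single j (by intro b _ hb; simp [hb]) (by simp [hj])] at h3
    simpa using h3
  · rw [coeff_eq_zero_of_natDegree_lt (by omega), map_zero]

open Polynomial in
/-- The iterates of a unipotent endomorphism depend polynomially on the exponent. -/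
theorem exists_polynomial_eval_eq_iterate {C : Type*} [CommRing C] [Algebra ℚ C]
    (Ψ : Module.End ℚ C) (N : ℕ) (hN : (Ψ - 1) ^ N = 0) (c : C) :
    ∃ p : C[X], ∀ s : ℕ, p.eval (s : C) = (Ψ ^ s) c := by
  refine ⟨∑ i ∈ Finset.range N, Polynomial.C (((Ψ - 1) ^ i) c) *
    ((i.factorial : ℚ)⁻¹ • descPochhammer ℚ i).map (algebraMap ℚ C), fun s => ?_⟩
  have hs : Ψ ^ s = ∑ i ∈ Finset.range N, (s.choose i : ℚ) • (Ψ - 1) ^ i := by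
    conv_lhs => rw [← sub_add_cancel Ψ 1, (Commute.one_right _).add_pow]
    have h1 : ∀ i, (Ψ - 1) ^ i * 1 ^ (s - i) * (s.choose i : Module.End ℚ C) =
        (s.choose i : ℚ) • (Ψ - 1) ^ i := by
      intro i
      rw [one_pow, mul_one, ← Nat.cast_comm, ← nsmul_eq_mul, Nat.cast_smul_eq_nsmul]
    simp_rw [h1]
    rw [Finset.sum_subset (Finset.range_mono (le_max_left (s + 1) N)),
      Finset.sum_subset (Finset.range_mono (le_max_right (s + 1) N))]
    · intro i _ hi
      rw [pow_eq_zero_of_le (by simpa using hi) hN, smul_zero]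
    · intro i _ hi
      rw [Nat.choose_eq_zero_of_lt (by simpa using hi), Nat.cast_zero, zero_smul]
  rw [hs, eval_finsetSum, LinearMap.sum_apply]
  refine Finset.sum_congr rfl fun i _ => ?_
  have h2 : eval (s : C) (((i.factorial : ℚ)⁻¹ • descPochhammer ℚ i).map (algebraMap ℚ C)) =
      algebraMap ℚ C (s.choose i) := by
    rw [← map_natCast (algebraMap ℚ C) s, eval_map_algebraMap, aeval_algebraMap_apply]
    congr 1
    rw [coe_aeval_eq_eval, eval_smul, descPochhammer_eval_eq_descFactorial,
      Nat.descFactorial_eq_factorial_mul_choose]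
    have := Nat.factorial_ne_zero i
    push_cast
    rw [smul_eq_mul, ← mul_assoc, inv_mul_cancel₀ (by exact_mod_cast this), one_mul]
  rw [eval_mul, eval_C, h2, LinearMap.smul_apply, Algebra.smul_def, mul_comm]

open Polynomial in
/-- A unipotent algebra endomorphism `Ψ` preserves every ideal that is stable under derivations. If
`Ψ ^ s = ∑ s ^ j L_j`, then `L_1 = log Ψ` is a derivation and `L_j = L_1 ^ j / j!`. -/
theorem apply_mem_of_unipotent {K C : Type*} [Field K] [CharZero K] [CommRing C] [Algebra K C]
    (Ψ : C →ₐ[K] C) (N : ℕ) (hN : (Ψ.toLinearMap - 1) ^ N = 0) (J : Ideal C)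
    (hJ : ∀ D : Derivation K C C, ∀ c ∈ J, D c ∈ J) {c : C} (hc : c ∈ J) : Ψ c ∈ J := by
  let := DivisionRing.toRatAlgebra (R := K)
  let : Algebra ℚ C := Algebra.compHom C (algebraMap ℚ K)
  have : IsScalarTower ℚ K C := IsScalarTower.of_algebraMap_eq fun _ => rfl
  have hpow : ∀ (s : ℕ) (c : C), ((Ψ.toLinearMap.restrictScalars ℚ) ^ s) c = (Ψ ^ s) c := by
    intro s
    induction s with
    | zero => intro c; simp
    | succ s ih => intro c; rw [pow_succ, pow_succ]; exact ih _
  have hN' : ((Ψ.toLinearMap.restrictScalars ℚ) - 1) ^ N = 0 := by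
    have : ∀ (s : ℕ) (c : C), (((Ψ.toLinearMap.restrictScalars ℚ) - 1) ^ s) c =
        ((Ψ.toLinearMap - 1) ^ s) c := by
      intro s
      induction s with
      | zero => intro c; simp
      | succ s ih => intro c; rw [pow_succ, pow_succ]; exact ih _
    ext c
    rw [this, hN]
    simp
  choose F hF using exists_polynomial_eval_eq_iterate (Ψ.toLinearMap.restrictScalars ℚ) N hN'
  simp only [hpow] at hF
  have hadd : ∀ a b, F (a + b) = F a + F b := fun a b =>
    polynomial_eq_of_eval_natCast_eq fun s => by rw [eval_add, hF, hF, hF, map_add]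
  have hmul : ∀ a b, F (a * b) = F a * F b := fun a b =>
    polynomial_eq_of_eval_natCast_eq fun s => by rw [eval_mul, hF, hF, hF, map_mul]
  have hsmul : ∀ (k : K) a, F (k • a) = k • F a := fun k a =>
    polynomial_eq_of_eval_natCast_eq fun s => by rw [eval_smul, hF, hF, map_smul]
  have hzero : ∀ a, (F a).coeff 0 = a := fun a => by
    have := hF a 0
    rw [Nat.cast_zero, ← coeff_zero_eq_eval_zero] at this
    simpa using this
  let D : Derivation K C C := Derivation.mk'
    { toFun := fun a => (F a).coeff 1
      map_add' := fun a b => by rw [hadd, coeff_add]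
      map_smul' := fun k a => by rw [hsmul, coeff_smul]; rfl }
    fun a b => by
      change (F (a * b)).coeff 1 = a • (F b).coeff 1 + b • (F a).coeff 1
      rw [hmul, mul_coeff_one, hzero, hzero, smul_eq_mul, smul_eq_mul, mul_comm b]
  have hD : ∀ a, D a = (F a).coeff 1 := fun a => rfl
  have hDsum : ∀ (s : ℕ) a, D ((Ψ ^ s) a) = (derivative (F a)).eval (s : C) := by
    intro s a
    have : F ((Ψ ^ s) a) = taylor (s : C) (F a) := polynomial_eq_of_eval_natCast_eq fun t => by
      rw [hF, taylor_eval, ← Nat.cast_add, hF, pow_add]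
      rfl
    rw [hD, this, taylor_coeff_one]
  have hcoeff : ∀ (j : ℕ) a, D ((F a).coeff j) = (F a).coeff (j + 1) * (j + 1) := by
    intro j a
    rw [← coeff_derivative]
    have : derivative (F a) = ∑ i ∈ Finset.range ((F a).natDegree + 1),
        monomial i (D ((F a).coeff i)) := by
      refine polynomial_eq_of_eval_natCast_eq fun s => ?_
      rw [← hDsum, ← hF, eval_eq_sum_range, map_sum, eval_finsetSum]
      refine Finset.sum_congr rfl fun i _ => ?_
      have h2 : ∀ x : C, x * (s : C) ^ i = ((s : K) ^ i) • x := by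
        intro x
        rw [Algebra.smul_def, mul_comm]
        simp
      rw [eval_monomial, h2, h2, D.map_smul]
    rw [this, finsetSum_coeff]
    simp only [coeff_monomial]
    by_cases hj : j ∈ Finset.range ((F a).natDegree + 1)
    · rw [Finset.sum_eq_single j (by intro b _ hb; simp [hb]) (by simp [hj])]
      simp
    · rw [coeff_eq_zero_of_natDegree_lt (by simpa using hj), map_zero]
      refine (Finset.sum_eq_zero fun i hi => if_neg ?_).symm
      rintro rfl
      exact hj hi
  have hmem : ∀ j, (F c).coeff j ∈ J := by
    intro j
    induction j with
    | zero => rwa [hzero]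
    | succ j ih =>
      have h1 := hJ D _ ih
      rw [hcoeff] at h1
      have h2 : (F c).coeff (j + 1) = algebraMap ℚ C ((j : ℚ) + 1)⁻¹ *
          ((F c).coeff (j + 1) * (j + 1)) := by
        have : ((j : C) + 1) = algebraMap ℚ C ((j : ℚ) + 1) := by simp
        rw [mul_comm ((F c).coeff (j + 1)), ← mul_assoc, this, ← map_mul,
          inv_mul_cancel₀ (by positivity), map_one, one_mul]
      rw [h2]
      exact J.mul_mem_left _ h1
  have h1 := hF c 1
  rw [eval_eq_sum_range, pow_one] at h1
  rw [← h1]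
  exact sum_mem fun i _ => J.mul_mem_right _ (hmem i)

end Unipotent

/-! ### Families over an affine base -/

section Deformation

variable {K A : Type*} [Field K] [CommRing A] [Algebra K A]

/-- The member at the point `r` of `Spec R` of the family of endomorphisms of `A` given by a
homomorphism `A → R ⊗ A`. -/
def specialize {R : Type*} (A : Type*) [CommRing R] [Algebra K R] [CommRing A] [Algebra K A]
    (r : R →ₐ[K] K) : R ⊗[K] A →ₐ[K] A :=
  Algebra.TensorProduct.lift ((Algebra.ofId K A).comp r) (AlgHom.id K A) fun _ _ => Commute.all _ _

@[simp]
theorem specialize_tmul {R : Type*} [CommRing R] [Algebra K R] (r : R →ₐ[K] K) (x : R) (f : A) :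
    specialize A r (x ⊗ₜ[K] f) = r x • f := by
  simp [specialize, Algebra.ofId_apply, Algebra.smul_def]

theorem eq_zero_of_forall_functional {S B : Type*} [AddCommGroup S] [Module K S]
    [AddCommGroup B] [Module K B] (c : S ⊗[K] B)
    (h : ∀ l : Module.Dual K S, TensorProduct.lid K B (l.rTensor B c) = 0) : c = 0 := by
  have b := Module.Free.chooseBasis K B
  apply (TensorProduct.equivFinsuppOfBasisRight (M := S) b).injective
  rw [map_zero]
  ext i
  rw [Finsupp.zero_apply, ← Module.forall_dual_apply_eq_zero_iff K]
  intro l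
  have key : ∀ c : S ⊗[K] B, l (TensorProduct.equivFinsuppOfBasisRight b c i) =
      b.repr (TensorProduct.lid K B (l.rTensor B c)) i := by
    intro c
    induction c using TensorProduct.induction_on with
    | zero => simp
    | add x y hx hy => simp only [map_add, Finsupp.add_apply, hx, hy]
    | tmul x y => simp [mul_comm]
  rw [key, h, map_zero, Finsupp.zero_apply]

theorem map_includeRight_eq_ker (S : Type*) [CommRing S] [Algebra K S] (I : Ideal A) :
    I.map (Algebra.TensorProduct.includeRight : A →ₐ[K] S ⊗[K] A) =
      RingHom.ker (Algebra.TensorProduct.map (AlgHom.id K S) (Ideal.Quotient.mkₐ K I)) := by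
  rw [Algebra.TensorProduct.lTensor_ker _ (Ideal.Quotient.mkₐ_surjective K I)]
  congr 1
  exact (Ideal.Quotient.mkₐ_ker K I).symm

/-- The extension of a derivation-stable ideal to a tensor product is derivation-stable. -/
theorem derivation_mem_map_includeRight {S : Type*} [CommRing S] [Algebra K S] {I : Ideal A}
    (hI : ∀ D : Derivation K A A, ∀ f ∈ I, D f ∈ I) (D : Derivation K (S ⊗[K] A) (S ⊗[K] A))
    {c : S ⊗[K] A} (hc : c ∈ I.map (Algebra.TensorProduct.includeRight : A →ₐ[K] S ⊗[K] A)) :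
    D c ∈ I.map (Algebra.TensorProduct.includeRight : A →ₐ[K] S ⊗[K] A) := by
  have base : ∀ f ∈ I, D (1 ⊗ₜ[K] f) ∈
      I.map (Algebra.TensorProduct.includeRight : A →ₐ[K] S ⊗[K] A) := by
    intro f hf
    rw [map_includeRight_eq_ker, RingHom.mem_ker]
    refine eq_zero_of_forall_functional _ fun l => ?_
    let δ : S ⊗[K] A →ₗ[K] A := (TensorProduct.lid K A).toLinearMap ∘ₗ l.rTensor A
    have hδ : ∀ (a : A) (x : S ⊗[K] A), δ ((1 ⊗ₜ[K] a) * x) = a * δ x := by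
      intro a x
      induction x using TensorProduct.induction_on with
      | zero => simp
      | add x y hx hy => rw [mul_add, map_add, hx, hy, map_add, mul_add]
      | tmul s b => simp [δ]
    let d : Derivation K A A := Derivation.mk'
      (δ ∘ₗ D.toLinearMap ∘ₗ (Algebra.TensorProduct.includeRight : A →ₐ[K] S ⊗[K] A).toLinearMap)
      fun a b => by
        change δ (D (1 ⊗ₜ[K] (a * b))) = a • δ (D (1 ⊗ₜ[K] b)) + b • δ (D (1 ⊗ₜ[K] a))
        rw [show (1 : S) ⊗ₜ[K] (a * b) = (1 ⊗ₜ[K] a) * (1 ⊗ₜ[K] b) by simp, D.leibniz, map_add,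
          smul_eq_mul, smul_eq_mul, hδ, hδ, smul_eq_mul, smul_eq_mul]
    have hd : δ (D (1 ⊗ₜ[K] f)) ∈ I := hI d f hf
    have hcomm : ∀ x : S ⊗[K] A, TensorProduct.lid K (A ⧸ I) (l.rTensor (A ⧸ I)
        (Algebra.TensorProduct.map (AlgHom.id K S) (Ideal.Quotient.mkₐ K I) x)) =
        Ideal.Quotient.mkₐ K I (δ x) := by
      intro x
      induction x using TensorProduct.induction_on with
      | zero => simp
      | add x y hx hy => simp only [map_add, hx, hy]
      | tmul s b => simp [δ]
    rw [hcomm]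
    exact Ideal.Quotient.eq_zero_iff_mem.mpr hd
  refine Submodule.span_induction ?_ (by simp) (fun x y _ _ hx hy => by
    rw [map_add]; exact add_mem hx hy) (fun a x hx' hx => ?_) hc
  · rintro _ ⟨f, hf, rfl⟩
    exact base f hf
  · rw [smul_eq_mul, D.leibniz]
    exact add_mem (Ideal.mul_mem_left _ _ hx) (Ideal.mul_mem_right _ _ hx')

/-- An infinitesimal deformation of the identity over a nilpotent thickening preserves
derivation-stable ideals. -/
theorem apply_mem_map_of_nilpotent [CharZero K] {S : Type*} [CommRing S] [Algebra K S]
    (𝔪 : Ideal S) (N : ℕ) (hN : 𝔪 ^ N = ⊥) (Φ : A →ₐ[K] S ⊗[K] A)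
    (hΦ : ∀ f, Φ f - 1 ⊗ₜ[K] f ∈
      𝔪.map (Algebra.TensorProduct.includeLeft : S →ₐ[K] S ⊗[K] A)) {I : Ideal A}
    (hI : ∀ D : Derivation K A A, ∀ f ∈ I, D f ∈ I) {f : A} (hf : f ∈ I) :
    Φ f ∈ I.map (Algebra.TensorProduct.includeRight : A →ₐ[K] S ⊗[K] A) := by
  set ι : S →ₐ[K] S ⊗[K] A := Algebra.TensorProduct.includeLeft
  let Ψ : S ⊗[K] A →ₐ[K] S ⊗[K] A :=
    Algebra.TensorProduct.lift ι Φ fun _ _ => Commute.all _ _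
  have hΨ : ∀ s f, Ψ (s ⊗ₜ[K] f) = ι s * Φ f := fun s f => by simp [Ψ]
  have hΨι : ∀ s, Ψ (ι s) = ι s := fun s => by
    change Ψ (s ⊗ₜ[K] 1) = _
    rw [hΨ, map_one, mul_one]
  -- `Ψ - 1` shifts the filtration by the powers of `𝔪`.
  have h0 : ∀ x, Ψ x - x ∈ 𝔪.map ι := by
    intro x
    induction x using TensorProduct.induction_on with
    | zero => simp
    | add x y hx hy =>
      rw [map_add, add_sub_add_comm]
      exact add_mem hx hy
    | tmul s b =>
      have : Ψ (s ⊗ₜ[K] b) - s ⊗ₜ[K] b = ι s * (Φ b - 1 ⊗ₜ[K] b) := by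
        rw [hΨ, mul_sub]
        simp [ι]
      rw [this]
      exact Ideal.mul_mem_left _ _ (hΦ b)
  have hshift : ∀ (k : ℕ) (x), x ∈ (𝔪.map ι) ^ k → Ψ x - x ∈ (𝔪.map ι) ^ (k + 1) := by
    intro k x hx
    rw [← Ideal.map_pow] at hx
    refine Submodule.span_induction ?_ (by simp) (fun x y _ _ hx hy => by
      rw [map_add, add_sub_add_comm]; exact add_mem hx hy) (fun a x hx' hx => ?_) hx
    · rintro _ ⟨s, -, rfl⟩
      rw [hΨι, sub_self]
      exact zero_mem _
    · have h1 : Ψ (a • x) - a • x = Ψ a * (Ψ x - x) + x * (Ψ a - a) := by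
        rw [smul_eq_mul, map_mul]; ring
      rw [h1]
      refine add_mem (Ideal.mul_mem_left _ _ hx) ?_
      rw [pow_succ, ← Ideal.map_pow]
      exact Ideal.mul_mem_mul hx' (h0 a)
  have hnil : (Ψ.toLinearMap - 1) ^ N = 0 := by
    have : ∀ k x, ((Ψ.toLinearMap - 1) ^ k) x ∈ (𝔪.map ι) ^ k := by
      intro k
      induction k with
      | zero => intro x; simp
      | succ k ih => intro x; rw [pow_succ' (Ψ.toLinearMap - 1)]; exact hshift k _ (ih x)
    refine LinearMap.ext fun x => ?_
    have := this N x
    rw [← Ideal.map_pow, hN, Ideal.map_bot] at this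
    exact this
  have := apply_mem_of_unipotent Ψ N hnil _
    (fun D c hc => derivation_mem_map_includeRight hI D hc)
    (Ideal.mem_map_of_mem (Algebra.TensorProduct.includeRight : A →ₐ[K] S ⊗[K] A) hf)
  have h1 : Ψ (Algebra.TensorProduct.includeRight f) = Φ f := by
    change Ψ (1 ⊗ₜ[K] f) = _
    rw [hΨ, map_one, one_mul]
  rwa [h1] at this

/-- The members of an algebraic family of endomorphisms over an irreducible affine base that
contains the identity preserve derivation-stable ideals: near the identity this holds to all
infinitesimal orders, hence everywhere by Krull's intersection theorem. -/
theorem specialize_mem_of_derivation_stable [CharZero K] {R : Type*} [CommRing R] [IsDomain R]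
    [IsNoetherianRing R] [Algebra K R] (Φ : A →ₐ[K] R ⊗[K] A) (r₀ r₁ : R →ₐ[K] K)
    (h₀ : ∀ f, specialize A r₀ (Φ f) = f) {I : Ideal A}
    (hI : ∀ D : Derivation K A A, ∀ f ∈ I, D f ∈ I) {f : A} (hf : f ∈ I) :
    specialize A r₁ (Φ f) ∈ I := by
  set 𝔪 := RingHom.ker r₀
  have hker : ∀ c : R ⊗[K] A, c - 1 ⊗ₜ[K] specialize A r₀ c ∈
      𝔪.map (Algebra.TensorProduct.includeLeft : R →ₐ[K] R ⊗[K] A) := by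
    intro c
    induction c using TensorProduct.induction_on with
    | zero => simp
    | add x y hx hy =>
      rw [map_add, tmul_add, add_sub_add_comm]
      exact add_mem hx hy
    | tmul s b =>
      have h1 : s ⊗ₜ[K] b - 1 ⊗ₜ[K] specialize A r₀ (s ⊗ₜ[K] b) =
          Algebra.TensorProduct.includeLeft (S := K) (s - algebraMap K R (r₀ s)) *
            (1 : R) ⊗ₜ[K] b := by
        simp [sub_tmul, sub_mul, Algebra.algebraMap_eq_smul_one, smul_tmul]
      rw [h1]
      refine Ideal.mul_mem_right _ _ (Ideal.mem_map_of_mem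
        (Algebra.TensorProduct.includeLeft : R →ₐ[K] R ⊗[K] A) ?_)
      simp [𝔪, RingHom.mem_ker]
  let q : R ⊗[K] A →ₐ[K] R ⊗[K] (A ⧸ I) :=
    Algebra.TensorProduct.map (AlgHom.id K R) (Ideal.Quotient.mkₐ K I)
  suffices hq : q (Φ f) = 0 by
    rw [← Ideal.Quotient.eq_zero_iff_mem]
    have h2 : ∀ c : R ⊗[K] A, Ideal.Quotient.mk I (specialize A r₁ c) =
        specialize (A ⧸ I) r₁ (q c) := by
      intro c
      induction c using TensorProduct.induction_on with
      | zero => simp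
      | add x y hx hy => simp only [map_add, hx, hy]
      | tmul s b =>
        rw [specialize_tmul, Algebra.TensorProduct.map_tmul, specialize_tmul]
        exact map_smul (Ideal.Quotient.mkₐ K I) _ _
    rw [h2, hq, map_zero]
  have b := Module.Free.chooseBasis K (A ⧸ I)
  apply (TensorProduct.equivFinsuppOfBasisRight (M := R) b).injective
  rw [map_zero]
  ext i
  rw [Finsupp.zero_apply, ← Ideal.mem_bot,
    ← Ideal.iInf_pow_eq_bot_of_isDomain 𝔪 (RingHom.ker_ne_top r₀), Ideal.mem_iInf]
  intro N
  let π : R →ₐ[K] R ⧸ 𝔪 ^ N := Ideal.Quotient.mkₐ K (𝔪 ^ N)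
  let πA : R ⊗[K] A →ₐ[K] (R ⧸ 𝔪 ^ N) ⊗[K] A := Algebra.TensorProduct.map π (AlgHom.id K A)
  have hmap : ∀ c ∈ 𝔪.map (Algebra.TensorProduct.includeLeft : R →ₐ[K] R ⊗[K] A), πA c ∈
      (𝔪.map π).map (Algebra.TensorProduct.includeLeft :
        R ⧸ 𝔪 ^ N →ₐ[K] (R ⧸ 𝔪 ^ N) ⊗[K] A) := by
    intro c hc
    have h3 := Ideal.mem_map_of_mem πA hc
    rw [Ideal.map_mapₐ] at h3 ⊢
    have h4 : πA.comp Algebra.TensorProduct.includeLeft = (Algebra.TensorProduct.includeLeft :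
        R ⧸ 𝔪 ^ N →ₐ[K] (R ⧸ 𝔪 ^ N) ⊗[K] A).comp π := by
      ext s
      simp [πA]
    rwa [h4] at h3
  have h5 := apply_mem_map_of_nilpotent (𝔪.map π) N (by
      rw [← Ideal.map_pow]
      exact Ideal.map_quotient_self _) (πA.comp Φ) (fun g => by
      have := hmap _ (hker (Φ g))
      rw [h₀, map_sub] at this
      simpa [πA] using this) hI hf
  have h6 : Algebra.TensorProduct.map (AlgHom.id K (R ⧸ 𝔪 ^ N)) (Ideal.Quotient.mkₐ K I)
      (πA (Φ f)) = 0 := by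
    rw [← RingHom.mem_ker, ← map_includeRight_eq_ker]
    exact h5
  have h7 : ∀ c : R ⊗[K] A, π (TensorProduct.equivFinsuppOfBasisRight b (q c) i) =
      TensorProduct.equivFinsuppOfBasisRight b
        (Algebra.TensorProduct.map (AlgHom.id K (R ⧸ 𝔪 ^ N)) (Ideal.Quotient.mkₐ K I) (πA c)) i := by
    intro c
    induction c using TensorProduct.induction_on with
    | zero => simp
    | add x y hx hy => simp only [map_add, Finsupp.add_apply, hx, hy]
    | tmul s b => simp [q, πA]
  have h8 := h7 (Φ f)
  rw [h6, map_zero, Finsupp.zero_apply] at h8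
  exact Ideal.Quotient.eq_zero_iff_mem.mp h8

end Deformation

/-! ### The neutral component of the automorphism group -/

section Families

variable {K A : Type u} [Field K] [CommRing A] [Algebra K A]

theorem specMap_hom_injective {S T : Type u} [CommRing S] [CommRing T] {f g : S →+* T}
    (h : Spec.map (CommRingCat.ofHom f) = Spec.map (CommRingCat.ofHom g)) : f = g :=
  congrArg CommRingCat.Hom.hom (Spec.map_injective h)

theorem specMap_ofHom_comp {S T U : Type u} [CommRing S] [CommRing T] [CommRing U] (f : S →+* T)
    (g : T →+* U) : Spec.map (CommRingCat.ofHom g) ≫ Spec.map (CommRingCat.ofHom f) =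
      Spec.map (CommRingCat.ofHom (g.comp f)) := by
  rw [← Spec.map_comp, ← CommRingCat.ofHom_comp]

/-- The `K`-points of `Spec R` are the `K`-algebra homomorphisms `R → K`. -/
theorem exists_algHom_of_point {R : Type u} [CommRing R] [Algebra K R]
    (b : Spec (.of K) ⟶ Spec (.of R)) (hb : b ≫ strMap K R = 𝟙 _) :
    ∃ r : R →ₐ[K] K, b = Spec.map (CommRingCat.ofHom (r : R →+* K)) := by
  obtain ⟨r, rfl⟩ := Spec.map_surjective b
  have h : r.hom.comp (algebraMap K R) = RingHom.id K := by
    apply specMap_hom_injective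
    rw [← specMap_ofHom_comp]
    exact hb.trans (Spec.map_id _).symm
  exact ⟨{ r.hom with commutes' := fun k => RingHom.congr_fun h k }, rfl⟩

theorem specialize_comp_includeLeft {R : Type u} [CommRing R] [Algebra K R] (r : R →ₐ[K] K) :
    (specialize A r : R ⊗[K] A →+* A).comp Algebra.TensorProduct.includeLeftRingHom =
      (algebraMap K A).comp (r : R →+* K) := by
  ext x
  simp [Algebra.algebraMap_eq_smul_one]

theorem specialize_comp_includeRight {R : Type u} [CommRing R] [Algebra K R] (r : R →ₐ[K] K) :
    (specialize A r : R ⊗[K] A →+* A).comp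
      (Algebra.TensorProduct.includeRight : A →ₐ[K] R ⊗[K] A).toRingHom = RingHom.id A := by
  ext x
  simp

theorem injective_of_surjective_ringEnd {S : Type*} [CommRing S] [IsNoetherianRing S] (f : S →+* S)
    (hf : Function.Surjective f) : Function.Injective f := by
  have hmono : Monotone fun n : ℕ => RingHom.ker (f ^ n) :=
    monotone_nat_of_le_succ fun n x hx => by
      rw [RingHom.mem_ker] at hx ⊢
      rw [pow_succ', RingHom.mul_def, RingHom.comp_apply, hx, map_zero]
  obtain ⟨n, hn⟩ := monotone_stabilizes_iff_noetherian.mpr ‹IsNoetherianRing S› ⟨_, hmono⟩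
  have hsurj : Function.Surjective (f ^ n) := by
    rw [RingHom.coe_pow]
    exact hf.iterate n
  rw [injective_iff_map_eq_zero]
  intro x hx
  obtain ⟨y, rfl⟩ := hsurj x
  have hy : y ∈ RingHom.ker (f ^ (n + 1)) := by
    rw [RingHom.mem_ker, pow_succ', RingHom.mul_def, RingHom.comp_apply, hx]
  have hker : RingHom.ker (f ^ n) = RingHom.ker (f ^ (n + 1)) := hn (n + 1) n.le_succ
  rw [← hker] at hy
  exact hy

/-- A homomorphism `A → R ⊗ A` whose specializations are surjective, one of them being the identity,
gives an algebraic family of automorphisms over `Spec R` through the identity. -/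
theorem mem_autZero_of_family [IsAlgClosed K] [Algebra.FiniteType K A] {R : Type u} [CommRing R]
    [IsDomain R] [Algebra K R] [Algebra.FiniteType K R] (Φ : A →ₐ[K] R ⊗[K] A)
    (hΦ : ∀ r : R →ₐ[K] K, Function.Surjective ((specialize A r).comp Φ)) (r₀ r₁ : R →ₐ[K] K)
    (h₀ : ∀ f, specialize A r₀ (Φ f) = f) {φ : A ≃ₐ[K] A}
    (h₁ : ∀ f, specialize A r₁ (Φ f) = φ f) : φ ∈ autZero K A := by
  let F : pullback (strMap K R) (strMap K A) ⟶ Spec (.of A) :=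
    (pullbackSpecIso K R A).hom ≫ Spec.map (CommRingCat.ofHom (Φ : A →+* R ⊗[K] A))
  have hpt : ∀ r : R →ₐ[K] K, Spec.map (CommRingCat.ofHom (r : R →+* K)) ≫ strMap K R = 𝟙 _ := by
    intro r
    rw [strMap, specMap_ofHom_comp, AlgHom.comp_algebraMap]
    exact Spec.map_id _
  have hmem : ∀ (r : R →ₐ[K] K) hb, familyMember F (Spec.map (CommRingCat.ofHom (r : R →+* K))) hb =
      Spec.map (CommRingCat.ofHom ((specialize A r).comp Φ : A →+* A)) := by
    intro r hb
    have : pullback.lift (strMap K A ≫ Spec.map (CommRingCat.ofHom (r : R →+* K))) (𝟙 _)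
        (by rw [Category.assoc, hb]; simp) =
        Spec.map (CommRingCat.ofHom (specialize A r : R ⊗[K] A →+* A)) ≫
          (pullbackSpecIso K R A).inv := by
      apply pullback.hom_ext
      · rw [pullback.lift_fst, Category.assoc, pullbackSpecIso_inv_fst, specMap_ofHom_comp,
          specMap_ofHom_comp, specialize_comp_includeLeft]
      · rw [pullback.lift_snd, Category.assoc, pullbackSpecIso_inv_snd]
        exact (Spec.map_id _).symm.trans
          ((congrArg (fun f => Spec.map (CommRingCat.ofHom f))
            (specialize_comp_includeRight (A := A) r).symm).trans (specMap_ofHom_comp _ _).symm)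
    rw [familyMember, this, Category.assoc, Iso.inv_hom_id_assoc, specMap_ofHom_comp]
    rfl
  refine ⟨Spec (.of R), strMap K R, F, _, _, hpt r₀, hpt r₁, ⟨inferInstance, inferInstance,
    ?_, inferInstance⟩, ⟨?_, ?_⟩, ?_, ?_⟩
  · rw [HasRingHomProperty.Spec_iff (P := @LocallyOfFiniteType)]
    exact RingHom.finiteType_algebraMap.mpr inferInstance
  · rw [Category.assoc, specMap_ofHom_comp, AlgHom.comp_algebraMap]
    exact pullbackSpecIso_hom_base K R A
  · intro b hb
    obtain ⟨r, rfl⟩ := exists_algHom_of_point b hb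
    rw [hmem]
    have hnoeth : IsNoetherianRing A := Algebra.FiniteType.isNoetherianRing K A
    exact isIso_SpecMap_iff.mpr ⟨injective_of_surjective_ringEnd
      ((specialize A r).comp Φ : A →+* A) (hΦ r), hΦ r⟩
  · rw [hmem]
    have : ((specialize A r₀).comp Φ : A →+* A) = RingHom.id A := RingHom.ext h₀
    rw [this]
    exact Spec.map_id _
  · rw [hmem]
    have : ((specialize A r₁).comp Φ : A →+* A) = (φ : A →+* A) := RingHom.ext h₁
    rw [this]

/-- The restriction of an algebraic family to an affine open subscheme of its base, as a
homomorphism of algebras. -/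
theorem exists_affine_restriction {B : Scheme.{u}} {π : B ⟶ Spec (.of K)}
    (hB : IsIrreducibleVariety K π) {Φ : pullback π (strMap K A) ⟶ Spec (.of A)}
    (hΦ : IsAlgebraicFamily π Φ) {U : B.Opens} (hU : IsAffineOpen U) (hne : (U : Set B).Nonempty) :
    ∃ (R : Type u) (_ : CommRing R) (_ : IsDomain R) (_ : IsNoetherianRing R) (_ : Algebra K R)
      (F : A →ₐ[K] R ⊗[K] A), ∀ (b : Spec (.of K) ⟶ B) (hb : b ≫ π = 𝟙 _),
        b (IsLocalRing.closedPoint K) ∈ U → ∃ r : R →ₐ[K] K, familyMember Φ b hb =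
          Spec.map (CommRingCat.ofHom ((specialize A r).comp F : A →+* A)) := by
  obtain ⟨_, _, _, _⟩ := hB
  have : Nonempty U := hne.to_subtype
  let R : Type u := Γ(B, U)
  let j : Spec (.of R) ⟶ B := hU.fromSpec
  have hj : IsOpenImmersion j := inferInstanceAs (IsOpenImmersion hU.fromSpec)
  let _ : Algebra K R := (Spec.preimage (j ≫ π)).hom.toAlgebra
  have hstr : strMap K R = j ≫ π := Spec.map_preimage _
  have hft : Algebra.FiniteType K R := by
    have : LocallyOfFiniteType (strMap K R) := by rw [hstr]; infer_instance
    rw [HasRingHomProperty.Spec_iff (P := @LocallyOfFiniteType)] at this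
    exact RingHom.finiteType_algebraMap.mp this
  let ψ : Spec (.of (R ⊗[K] A)) ⟶ pullback π (strMap K A) :=
    pullback.lift (Spec.map (CommRingCat.ofHom Algebra.TensorProduct.includeLeftRingHom) ≫ j)
      (Spec.map (CommRingCat.ofHom
        (Algebra.TensorProduct.includeRight : A →ₐ[K] R ⊗[K] A).toRingHom)) (by
      rw [Category.assoc, ← hstr, specMap_ofHom_comp, specMap_ofHom_comp]
      congr 2
      exact (AlgHom.comp_algebraMap Algebra.TensorProduct.includeRight).symm)
  obtain ⟨F, hF⟩ := Spec.map_surjective (ψ ≫ Φ)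
  have hFK : F.hom.comp (algebraMap K A) = algebraMap K (R ⊗[K] A) := by
    apply specMap_hom_injective
    rw [← specMap_ofHom_comp]
    change Spec.map F ≫ strMap K A = _
    rw [hF, Category.assoc, hΦ.comp_str, pullback.lift_fst_assoc, Category.assoc, ← hstr,
      specMap_ofHom_comp]
  let F' : A →ₐ[K] R ⊗[K] A := { F.hom with commutes' := RingHom.congr_fun hFK }
  refine ⟨R, inferInstance, inferInstance, Algebra.FiniteType.isNoetherianRing K R, inferInstance,
    F', fun b hb hbU => ?_⟩
  have hrange : Set.range b ⊆ Set.range j := by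
    rintro _ ⟨x, rfl⟩
    rw [show x = IsLocalRing.closedPoint K from Subsingleton.elim _ _]
    exact hU.range_fromSpec.symm ▸ hbU
  obtain ⟨r, hr⟩ := exists_algHom_of_point (IsOpenImmersion.lift j b hrange) (by
    rw [hstr, IsOpenImmersion.lift_fac_assoc, hb])
  have hb' : b = Spec.map (CommRingCat.ofHom (r : R →+* K)) ≫ j := by
    rw [← hr, IsOpenImmersion.lift_fac]
  refine ⟨r, ?_⟩
  have hlift : pullback.lift (strMap K A ≫ b) (𝟙 _) (by rw [Category.assoc, hb]; simp) =
      Spec.map (CommRingCat.ofHom (specialize A r : R ⊗[K] A →+* A)) ≫ ψ := by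
    apply pullback.hom_ext
    · rw [pullback.lift_fst, Category.assoc, pullback.lift_fst, hb', ← Category.assoc,
        ← Category.assoc, specMap_ofHom_comp, specMap_ofHom_comp, specialize_comp_includeLeft]
    · rw [pullback.lift_snd, Category.assoc, pullback.lift_snd, specMap_ofHom_comp,
        specialize_comp_includeRight]
      exact (Spec.map_id _).symm
  rw [familyMember, hlift, Category.assoc, ← hF]
  exact specMap_ofHom_comp F.hom _

/-- The neutral component of the automorphism group preserves the ideals that are stable under all
derivations. Two affine charts of the base, around the identity and around the given member, suffice:
they have a point in common, and the family over the second chart is normalized there. -/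
theorem apply_mem_of_mem_autZero [IsAlgClosed K] [CharZero K] {φ : A ≃ₐ[K] A}
    (hφ : φ ∈ autZero K A) {I : Ideal A} (hI : ∀ D : Derivation K A A, ∀ f ∈ I, D f ∈ I) {f : A}
    (hf : f ∈ I) : φ f ∈ I := by
  obtain ⟨B, π, Φ, b₀, b₁, h₀, h₁, hB, hΦ, e₀, e₁⟩ := hφ
  have := hB.integral
  have := hB.locallyOfFiniteType
  obtain ⟨U₀, hU₀, hb₀, -⟩ := exists_isAffineOpen_mem_and_subset
    (x := b₀ (IsLocalRing.closedPoint K)) (U := ⊤) trivial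
  obtain ⟨U₁, hU₁, hb₁, -⟩ := exists_isAffineOpen_mem_and_subset
    (x := b₁ (IsLocalRing.closedPoint K)) (U := ⊤) trivial
  obtain ⟨R₀, _, _, _, _, F₀, hF₀⟩ := exists_affine_restriction hB hΦ hU₀ ⟨_, hb₀⟩
  obtain ⟨R₁, _, _, _, _, F₁, hF₁⟩ := exists_affine_restriction hB hΦ hU₁ ⟨_, hb₁⟩
  have : JacobsonSpace B := LocallyOfFiniteType.jacobsonSpace π
  obtain ⟨c, ⟨hc₀, hc₁⟩, hc⟩ := nonempty_inter_closedPoints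
    (nonempty_preirreducible_inter U₀.2 U₁.2 ⟨_, hb₀⟩ ⟨_, hb₁⟩) (U₀.2.inter U₁.2).isLocallyClosed
  have hq : pointOfClosedPoint π c hc ≫ π = 𝟙 _ := pointOfClosedPoint_comp π c hc
  have hqc : pointOfClosedPoint π c hc (IsLocalRing.closedPoint K) = c :=
    pointOfClosedPoint_apply π c hc _
  obtain ⟨r₀, hr₀⟩ := hF₀ b₀ h₀ hb₀
  obtain ⟨s₀, hs₀⟩ := hF₀ _ hq (by rw [hqc]; exact hc₀)
  obtain ⟨s₁, hs₁⟩ := hF₁ _ hq (by rw [hqc]; exact hc₁)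
  obtain ⟨r₁, hr₁⟩ := hF₁ b₁ h₁ hb₁
  have hid : ((specialize A r₀).comp F₀ : A →+* A) = RingHom.id A := by
    apply specMap_hom_injective
    rw [← hr₀, e₀]
    exact (Spec.map_id _).symm
  have hss : ((specialize A s₁).comp F₁ : A →+* A) = ((specialize A s₀).comp F₀ : A →+* A) :=
    specMap_hom_injective (hs₁.symm.trans hs₀)
  have hφ : ((specialize A r₁).comp F₁ : A →+* A) = (φ : A →+* A) :=
    specMap_hom_injective (hr₁.symm.trans e₁)
  have hs₀I : specialize A s₀ (F₀ f) ∈ I := specialize_mem_of_derivation_stable F₀ r₀ s₀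
    (fun f => RingHom.congr_fun hid f) hI hf
  have hbij : Function.Bijective ((specialize A s₁).comp F₁) := by
    have h1 : IsIso (Spec.map (CommRingCat.ofHom ((specialize A s₁).comp F₁ : A →+* A))) := by
      rw [← hs₁]; exact hΦ.isIso _ hq
    exact isIso_SpecMap_iff.mp h1
  let e := AlgEquiv.ofBijective _ hbij
  have he : ∀ g, specialize A s₁ (F₁ (e.symm g)) = g := fun g => e.apply_symm_apply g
  have hef : e f ∈ I := by
    have : e f = specialize A s₀ (F₀ f) := RingHom.congr_fun hss f
    rwa [this]
  have := specialize_mem_of_derivation_stable (F₁.comp (e.symm : A →ₐ[K] A)) s₁ r₁ he hI hef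
  have h3 : specialize A r₁ (F₁ (e.symm (e f))) = φ f := by
    rw [e.symm_apply_apply]
    exact RingHom.congr_fun hφ f
  rw [← h3]
  exact this

end Families

/-! ### Semigroup algebras and their derivations -/

section SemigroupAlgebra

variable {K A M : Type*} [Field K] [CommRing A] [Algebra K A] [AddCommGroup M] {P : AddSubmonoid M}
  (j : AddMonoidAlgebra K P ≃ₐ[K] A)

/-- The monomial `χ^m` of an algebra identified with the semigroup algebra of `P`. -/
def monomial (m : P) : A := j (AddMonoidAlgebra.single m 1)

theorem monomial_add (a b : P) : monomial j (a + b) = monomial j a * monomial j b := by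
  simp [monomial, ← map_mul, AddMonoidAlgebra.single_mul_single]

theorem monomial_zero : monomial j 0 = 1 := by
  rw [monomial, ← AddMonoidAlgebra.one_def, map_one]

theorem span_range_monomial : Submodule.span K (Set.range (monomial j)) = ⊤ := by
  rw [eq_top_iff]
  intro f _
  obtain ⟨g, rfl⟩ := j.surjective f
  induction g using AddMonoidAlgebra.induction_on with
  | of m => exact Submodule.subset_span ⟨m, rfl⟩
  | add a b ha hb => rw [map_add]; exact add_mem (ha trivial) (hb trivial)
  | smul r a ha => rw [map_smul]; exact Submodule.smul_mem _ _ (ha trivial)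

theorem linearMap_ext_monomial {V : Type*} [AddCommMonoid V] [Module K V] {f g : A →ₗ[K] V}
    (h : ∀ m, f (monomial j m) = g (monomial j m)) : f = g :=
  LinearMap.ext_on_range (span_range_monomial j) h

/-- The homomorphism with given values on monomials. -/
def liftMonomial {B : Type*} [CommRing B] [Algebra K B] (g : Multiplicative P →* B) : A →ₐ[K] B :=
  (AddMonoidAlgebra.lift K B P g).comp (j.symm : A →ₐ[K] AddMonoidAlgebra K P)

@[simp]
theorem liftMonomial_monomial {B : Type*} [CommRing B] [Algebra K B] (g : Multiplicative P →* B)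
    (m : P) : liftMonomial j g (monomial j m) = g (Multiplicative.ofAdd m) := by
  simp [liftMonomial, monomial]

/-- The coefficient of a function at a lattice point, which is zero outside of `P`. -/
def coeffAt (v : M) : A →ₗ[K] K where
  toFun f := (AddMonoidAlgebra.mapDomainAlgHom K K P.subtype (j.symm f)).coeff v
  map_add' f g := by rw [map_add, map_add]; rfl
  map_smul' c f := by rw [map_smul, map_smul]; rfl

open Classical in
theorem coeffAt_monomial (v : M) (m : P) :
    coeffAt j v (monomial j m) = if (m : M) = v then 1 else 0 := by
  simp [coeffAt, monomial, Finsupp.single_apply]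

theorem mem_of_coeffAt_ne_zero {v : M} {f : A} (h : coeffAt j v f ≠ 0) : v ∈ P := by
  by_contra hv
  have h0 : coeffAt j v = 0 := linearMap_ext_monomial j fun m => by
    rw [coeffAt_monomial, if_neg, LinearMap.zero_apply]
    rintro rfl
    exact hv m.2
  exact h (by rw [h0, LinearMap.zero_apply])

theorem coeffAt_monomial_mul (a : P) (v : M) (f : A) :
    coeffAt j (a + v) (monomial j a * f) = coeffAt j v f := by
  have : coeffAt j (a + v) ∘ₗ LinearMap.mulLeft K (monomial j a) = coeffAt j v :=
    linearMap_ext_monomial j fun m => by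
      rw [LinearMap.comp_apply, LinearMap.mulLeft_apply, ← monomial_add, coeffAt_monomial,
        coeffAt_monomial, AddSubmonoid.coe_add]
      by_cases h : (m : M) = v <;> simp [h]
  exact LinearMap.congr_fun this f

theorem coeffAt_coe (m : P) (f : A) : coeffAt j m f = (j.symm f).coeff m := by
  simp only [coeffAt, LinearMap.coe_mk, AddHom.coe_mk]
  exact Finsupp.mapDomain_apply Subtype.val_injective _ _

theorem eq_sum_monomial (f : A) :
    f = ∑ m ∈ (j.symm f).coeff.support, coeffAt j m f • monomial j m := by
  apply j.symm.injective
  rw [map_sum]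
  conv_lhs => rw [← AddMonoidAlgebra.sum_coeff_single (j.symm f)]
  refine Finset.sum_congr rfl fun m _ => ?_
  rw [map_smul, coeffAt_coe, monomial, j.symm_apply_apply]
  simp

theorem mem_of_monomial_mem (V : Submodule K A) (f : A)
    (h : ∀ m : P, coeffAt j m f ≠ 0 → monomial j m ∈ V) : f ∈ V := by
  rw [eq_sum_monomial j f]
  refine sum_mem fun m _ => ?_
  by_cases h0 : coeffAt j m f = 0
  · rw [h0, zero_smul]; exact zero_mem _
  · exact Submodule.smul_mem _ _ (h m h0)

open Classical in
/-- The projection onto the span of the monomials in a face `S` of `P`. -/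
def truncation (S : AddSubmonoid M) (hS : ∀ a ∈ P, ∀ b ∈ P, a + b ∈ S → a ∈ S) : A →ₐ[K] A :=
  liftMonomial j
    { toFun := fun m => if (m.toAdd : M) ∈ S then monomial j m.toAdd else 0
      map_one' := by
        rw [if_pos]
        · exact monomial_zero j
        · exact S.zero_mem
      map_mul' := fun a b => by
        by_cases ha : (a.toAdd : M) ∈ S <;> by_cases hb : (b.toAdd : M) ∈ S
        · rw [if_pos ha, if_pos hb, if_pos]
          · exact monomial_add j _ _
          · exact S.add_mem ha hb
        · rw [if_neg hb, if_neg, mul_zero]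
          intro h
          refine hb (hS _ b.toAdd.2 _ a.toAdd.2 ?_)
          rw [add_comm]
          exact h
        · rw [if_neg ha, if_neg, zero_mul]
          exact fun h => ha (hS _ a.toAdd.2 _ b.toAdd.2 h)
        · rw [if_neg ha, if_neg, zero_mul]
          exact fun h => ha (hS _ a.toAdd.2 _ b.toAdd.2 h) }

variable {S : AddSubmonoid M} (hS : ∀ a ∈ P, ∀ b ∈ P, a + b ∈ S → a ∈ S)

open Classical in
theorem truncation_monomial (m : P) :
    truncation j S hS (monomial j m) = if (m : M) ∈ S then monomial j m else 0 := by
  simp [truncation]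

/-- The ideal spanned by the monomials outside of a face `S` of `P`. -/
theorem mem_ker_truncation_iff {f : A} :
    f ∈ RingHom.ker (truncation j S hS) ↔ ∀ m : P, (m : M) ∈ S → coeffAt j m f = 0 := by
  classical
  have hcoeff : ∀ (m : P) (f : A), coeffAt j m (truncation j S hS f) =
      if (m : M) ∈ S then coeffAt j m f else 0 := by
    intro m f
    have : coeffAt j m ∘ₗ (truncation j S hS).toLinearMap =
        if (m : M) ∈ S then coeffAt j m else 0 := linearMap_ext_monomial j fun b => ?_
    · have := LinearMap.congr_fun this f
      rw [LinearMap.comp_apply, AlgHom.toLinearMap_apply] at this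
      rw [this]
      split_ifs <;> rfl
    rw [LinearMap.comp_apply, AlgHom.toLinearMap_apply]
    rw [truncation_monomial]
    by_cases hb : (b : M) ∈ S
    · rw [if_pos hb]
      split_ifs with hm
      · rfl
      · rw [coeffAt_monomial, if_neg, LinearMap.zero_apply]
        intro h
        exact hm (h ▸ hb)
    · rw [if_neg hb, map_zero]
      split_ifs with hm
      · rw [coeffAt_monomial, if_neg]
        intro h
        exact hb (h ▸ hm)
      · rfl
  rw [RingHom.mem_ker]
  constructor
  · intro h m hm
    have := hcoeff m f
    rw [h, map_zero, if_pos hm] at this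
    exact this.symm
  · intro h
    have : truncation j S hS f ∈ (⊥ : Submodule K A) := by
      refine mem_of_monomial_mem j _ _ fun m hm => absurd ?_ hm
      rw [hcoeff]
      split_ifs with hmS
      · exact h m hmS
      · rfl
    exact this

/-- The coefficient function of the homogeneous component of degree `e` of a derivation. -/
def derivationComponent (D : Derivation K A A) (e : M) : P →+ K where
  toFun m := coeffAt j (m + e) (D (monomial j m))
  map_zero' := by rw [monomial_zero, D.map_one_eq_zero, map_zero]
  map_add' a b := by
    rw [monomial_add, D.leibniz, map_add, smul_eq_mul, smul_eq_mul, AddSubmonoid.coe_add,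
      add_assoc, coeffAt_monomial_mul, ← add_assoc, add_comm (a : M), add_assoc,
      coeffAt_monomial_mul, add_comm]

/-- If a face admits no roots, then its ideal is stable under all derivations. -/
theorem derivation_mem_ker_truncation [CharZero K] [Module.Free ℤ M] [Module.Finite ℤ M]
    (hP : P.FG) (hgen : AddSubgroup.closure (P : Set M) = ⊤)
    (hsat : ∀ (m : M) (k : ℕ), 0 < k → k • m ∈ P → m ∈ P) {τ : PointedCone ℚ (ℚ ⊗[ℤ] M)}
    (hτ : τ.IsFaceOf (weightCone (P : Set M)))
    (hSτ : ∀ m ∈ P, m ∈ S ↔ (1 : ℚ) ⊗ₜ[ℤ] m ∈ τ)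
    (hroot : ∀ e, ¬ IsFaceRoot (P : Set M) τ e) (D : Derivation K A A) {f : A}
    (hf : f ∈ RingHom.ker (truncation j S hS)) : D f ∈ RingHom.ker (truncation j S hS) := by
  rw [mem_ker_truncation_iff] at hf
  let V : Submodule K A :=
    ((RingHom.ker (truncation j S hS)).restrictScalars K).comap D.toLinearMap
  have : f ∈ V := by
    refine mem_of_monomial_mem j V f fun m hm => ?_
    have hmS : (m : M) ∉ S := fun h => hm (hf m h)
    change D (monomial j m) ∈ RingHom.ker (truncation j S hS)
    rw [mem_ker_truncation_iff]
    intro u hu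
    by_contra hne
    refine hroot ((u : M) - m) (isFaceRoot_of_apply_ne_zero hP hgen hsat hτ
      (derivationComponent j D ((u : M) - m)) (fun a ha => mem_of_coeffAt_ne_zero j ha)
      (m := m) ?_ ?_ ?_)
    · rwa [← hSτ _ m.2]
    · rw [add_sub_cancel, ← hSτ _ u.2]
      exact hu
    · change coeffAt j _ _ ≠ 0
      rwa [add_sub_cancel]
  exact this

end SemigroupAlgebra

/-! ### Root automorphisms -/

section RootAutomorphisms

variable {K A : Type u} {M : Type*} [Field K] [CommRing A] [Algebra K A] [AddCommGroup M]
  {P : AddSubmonoid M} (j : AddMonoidAlgebra K P ≃ₐ[K] A)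

open Classical in
/-- The monomial `χ^m`, or zero if `m` is not in `P`. -/
def monomialOrZero (m : M) : A := if h : m ∈ P then monomial j ⟨m, h⟩ else 0

theorem monomialOrZero_coe (m : P) : monomialOrZero j (m : M) = monomial j m := by
  rw [monomialOrZero, dif_pos m.2]

theorem monomialOrZero_mul {a b : M} (ha : a ∈ P) (hb : b ∈ P) :
    monomialOrZero j a * monomialOrZero j b = monomialOrZero j (a + b) := by
  have := monomial_add j ⟨a, ha⟩ ⟨b, hb⟩
  rw [← monomialOrZero_coe, ← monomialOrZero_coe, ← monomialOrZero_coe] at this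
  exact this.symm

variable {p : Module.Dual ℤ M} {e : M}

theorem add_nsmul_root_mem (hpe : p e = -1) (he : ∀ m ∈ P, 0 < p m → m + e ∈ P) {m : M}
    (hm : m ∈ P) {k : ℕ} (hk : (k : ℤ) ≤ p m) : m + k • e ∈ P := by
  induction k with
  | zero => simpa using hm
  | succ k ih =>
    rw [succ_nsmul, ← add_assoc]
    push_cast at hk
    refine he _ (ih (by omega)) ?_
    rw [map_add, map_nsmul, hpe]
    simp only [nsmul_eq_mul]
    linarith

open Polynomial in
theorem X_add_one_pow (n : ℕ) : (X + 1 : K[X]) ^ n =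
    ∑ k ∈ Finset.range (n + 1), (n.choose k : K) • (X : K[X]) ^ k := by
  rw [add_pow]
  refine Finset.sum_congr rfl fun k _ => ?_
  rw [one_pow, mul_one, mul_comm, ← nsmul_eq_mul, Nat.cast_smul_eq_nsmul]

open Polynomial in
/-- The image `χ^m (1 + X χ^e) ^ p(m)` of the monomial `χ^m` under the root subgroup of `e`. -/
def rootExpansion (p : Module.Dual ℤ M) (e m : M) : K[X] ⊗[K] A :=
  ∑ k ∈ Finset.range ((p m).toNat + 1), ((p m).toNat.choose k : K) •
    (((X : K[X]) ^ k) ⊗ₜ[K] monomialOrZero j (m + k • e))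

open Polynomial in
theorem rootExpansion_add (hp : ∀ m ∈ P, 0 ≤ p m) (hpe : p e = -1)
    (he : ∀ m ∈ P, 0 < p m → m + e ∈ P) {a b : M} (ha : a ∈ P) (hb : b ∈ P) :
    rootExpansion j p e (a + b) = rootExpansion j p e a * rootExpansion j p e b := by
  -- The linear map `θ` sends `X ^ i` to `X ^ i ⊗ χ^(a + b + i e)`, and both sides are its value at
  -- `(X + 1) ^ p(a + b)`.
  let θ : K[X] →ₗ[K] K[X] ⊗[K] A := (basisMonomials K).constr K fun i =>
    ((X : K[X]) ^ i) ⊗ₜ[K] monomialOrZero j (a + b + i • e)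
  have hθ : ∀ i, θ (X ^ i) = ((X : K[X]) ^ i) ⊗ₜ[K] monomialOrZero j (a + b + i • e) := by
    intro i
    have h : basisMonomials K i = X ^ i := by rw [coe_basisMonomials, X_pow_eq_monomial]
    rw [← (basisMonomials K).constr_basis K (fun i : ℕ => ((X : K[X]) ^ i) ⊗ₜ[K]
      monomialOrZero j (a + b + i • e)) i, h]
  have hab : (p (a + b)).toNat = (p a).toNat + (p b).toNat := by
    rw [map_add, Int.toNat_add (hp a ha) (hp b hb)]
  have h1 : rootExpansion j p e (a + b) = θ ((X + 1) ^ (p (a + b)).toNat) := by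
    rw [X_add_one_pow, map_sum]
    simp only [map_smul, hθ]
    rfl
  rw [h1, hab, pow_add, X_add_one_pow, X_add_one_pow, Finset.sum_mul_sum, rootExpansion,
    rootExpansion, Finset.sum_mul_sum, map_sum]
  refine Finset.sum_congr rfl fun k hk => ?_
  rw [map_sum]
  refine Finset.sum_congr rfl fun l hl => ?_
  have hka := add_nsmul_root_mem hpe he ha (k := k) (by
    have := hp a ha; have := Finset.mem_range.mp hk; omega)
  have hlb := add_nsmul_root_mem hpe he hb (k := l) (by
    have := hp b hb; have := Finset.mem_range.mp hl; omega)
  rw [smul_mul_smul_comm, smul_mul_smul_comm, ← pow_add, map_smul, hθ,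
    Algebra.TensorProduct.tmul_mul_tmul, monomialOrZero_mul j hka hlb, ← pow_add]
  congr 3
  rw [add_smul]
  abel

open Polynomial in
/-- The family of automorphisms of the root subgroup of `e`, that is
`χ^m ↦ χ^m (1 + X χ^e) ^ p(m)`. -/
def rootFamily (hp : ∀ m ∈ P, 0 ≤ p m) (hpe : p e = -1) (he : ∀ m ∈ P, 0 < p m → m + e ∈ P) :
    A →ₐ[K] K[X] ⊗[K] A :=
  liftMonomial j
    { toFun := fun m => rootExpansion j p e m.toAdd
      map_one' := by
        have h1 : monomialOrZero j (0 : M) = 1 :=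
          (monomialOrZero_coe j 0).trans (monomial_zero j)
        change rootExpansion j p e 0 = 1
        simp [rootExpansion, Algebra.TensorProduct.one_def, h1]
      map_mul' := fun a b => rootExpansion_add j hp hpe he a.toAdd.2 b.toAdd.2 }

open Polynomial in
theorem specialize_rootFamily_monomial (hp : ∀ m ∈ P, 0 ≤ p m) (hpe : p e = -1)
    (he : ∀ m ∈ P, 0 < p m → m + e ∈ P) (r : K[X] →ₐ[K] K) (m : P) :
    specialize A r (rootFamily j hp hpe he (monomial j m)) =
      ∑ k ∈ Finset.range ((p m).toNat + 1), ((p m).toNat.choose k : K) •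
        (r X ^ k • monomialOrZero j (m + k • e)) := by
  rw [rootFamily, liftMonomial_monomial]
  change specialize A r (rootExpansion j p e m) = _
  rw [rootExpansion, map_sum]
  refine Finset.sum_congr rfl fun k _ => ?_
  rw [map_smul, specialize_tmul, map_pow]

open Polynomial in
theorem surjective_specialize_rootFamily (hp : ∀ m ∈ P, 0 ≤ p m) (hpe : p e = -1)
    (he : ∀ m ∈ P, 0 < p m → m + e ∈ P) (r : K[X] →ₐ[K] K) :
    Function.Surjective ((specialize A r).comp (rootFamily j hp hpe he)) := by
  rw [← AlgHom.range_eq_top]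
  set Q := ((specialize A r).comp (rootFamily j hp hpe he)).range with hQ
  -- Modulo monomials with smaller value of `p` the specialization is the identity.
  have key : ∀ (n : ℕ) (m : P), (p m).toNat = n → monomial j m ∈ Q := by
    intro n
    induction n using Nat.strong_induction_on with
    | _ n ih =>
    intro m hm
    have h1 : (specialize A r).comp (rootFamily j hp hpe he) (monomial j m) ∈ Q := ⟨_, rfl⟩
    rw [AlgHom.comp_apply, specialize_rootFamily_monomial, Finset.sum_range_succ'] at h1
    have h2 := Q.sub_mem h1 (y := ∑ k ∈ Finset.range (p m).toNat, ((p m).toNat.choose (k + 1) : K) •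
        (r X ^ (k + 1) • monomialOrZero j ((m : M) + (k + 1) • e))) (by
      refine sum_mem fun k hk => Q.smul_mem (Q.smul_mem ?_ _) _
      have hk' := Finset.mem_range.mp hk
      have hmem := add_nsmul_root_mem hpe he m.2 (k := k + 1) (by
        have := hp m m.2; push_cast; omega)
      have h3 := ih ((p ((m : M) + (k + 1) • e)).toNat) (by
        rw [map_add, map_nsmul, hpe, nsmul_eq_mul]; push_cast; omega) ⟨_, hmem⟩ rfl
      rwa [← monomialOrZero_coe] at h3)
    rw [add_sub_cancel_left] at h2
    simpa [monomialOrZero_coe] using h2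
  rw [eq_top_iff]
  intro f _
  have : f ∈ Submodule.span K (Set.range (monomial j)) := by
    rw [span_range_monomial]; trivial
  refine (Submodule.span_le (p := Subalgebra.toSubmodule Q)).mpr ?_ this
  rintro _ ⟨m, rfl⟩
  exact key _ m rfl

open Polynomial in
/-- A Demazure root gives an automorphism in the neutral component. -/
theorem exists_root_automorphism [IsAlgClosed K] [IsDomain A] [Algebra.FiniteType K A]
    (hp : ∀ m ∈ P, 0 ≤ p m) (hpe : p e = -1) (he : ∀ m ∈ P, 0 < p m → m + e ∈ P) :
    ∃ φ ∈ autZero K A, (∀ m : P, p m = 0 → φ (monomial j m) = monomial j m) ∧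
      ∀ (m : P) (h : p m = 1), φ (monomial j m) =
        monomial j m + monomial j ⟨m + e, he m m.2 (h ▸ one_pos)⟩ := by
  have hsurj := surjective_specialize_rootFamily j hp hpe he
  have : IsNoetherianRing A := Algebra.FiniteType.isNoetherianRing K A
  have hbij : Function.Bijective ((specialize A (aeval (1 : K))).comp (rootFamily j hp hpe he)) :=
    ⟨injective_of_surjective_ringEnd ((specialize A (aeval (1 : K))).comp
      (rootFamily j hp hpe he) : A →+* A) (hsurj _), hsurj _⟩
  refine ⟨AlgEquiv.ofBijective _ hbij, mem_autZero_of_family (rootFamily j hp hpe he) hsurj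
    (aeval (0 : K)) (aeval (1 : K)) ?_ fun _ => rfl, fun m hm => ?_, fun m hm => ?_⟩
  · intro f
    have h : ((specialize A (aeval (0 : K))).comp (rootFamily j hp hpe he)).toLinearMap =
        LinearMap.id := linearMap_ext_monomial j fun m => by
      change specialize A (aeval (0 : K)) (rootFamily j hp hpe he (monomial j m)) = _
      rw [specialize_rootFamily_monomial, Finset.sum_range_succ', Finset.sum_eq_zero]
      · simp [monomialOrZero_coe]
      · intro k _
        simp
    exact LinearMap.congr_fun h f
  · change specialize A (aeval (1 : K)) (rootFamily j hp hpe he (monomial j m)) = _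
    rw [specialize_rootFamily_monomial, hm]
    simp [monomialOrZero_coe]
  · change specialize A (aeval (1 : K)) (rootFamily j hp hpe he (monomial j m)) = _
    have hm' : (p m).toNat = 1 := by rw [hm]; rfl
    rw [specialize_rootFamily_monomial, hm', ← monomialOrZero_coe, ← monomialOrZero_coe]
    simp [Finset.sum_range_succ]

end RootAutomorphisms

/-! ### Points and the Zariski topology -/

section ZariskiTopology

variable {K A : Type*} [Field K] [CommRing A] [Algebra K A]

/-- A point as the evaluation homomorphism. -/
def Points.toAlgHom (x : Points K A) : A →ₐ[K] K := x

theorem Points.eval_map (x : Points K A) (φ : A ≃ₐ[K] A) (f : A) :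
    (x.map φ).eval f = x.eval (φ f) := rfl

theorem Points.map_map (x : Points K A) (φ ψ : A ≃ₐ[K] A) : (x.map φ).map ψ = x.map (φ * ψ) := rfl

theorem Points.mem_toPrimeSpectrum_iff (x : Points K A) (f : A) :
    f ∈ x.toPrimeSpectrum.asIdeal ↔ x.eval f = 0 := RingHom.mem_ker

/-- A point lies in the closure of a set if all functions vanishing on the set vanish at it. -/
theorem Points.mem_closure_iff {Z : Set (Points K A)} {x : Points K A} :
    x ∈ closure Z ↔ ∀ f : A, (∀ z ∈ Z, z.eval f = 0) → x.eval f = 0 := by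
  have h : x ∈ closure Z ↔
      x.toPrimeSpectrum ∈ closure ((Points.toPrimeSpectrum : Points K A → _) '' Z) :=
    closure_induced
  rw [h, ← PrimeSpectrum.zeroLocus_vanishingIdeal_eq_closure,
    PrimeSpectrum.mem_zeroLocus]
  refine forall_congr' fun f => ?_
  rw [SetLike.mem_coe, PrimeSpectrum.mem_vanishingIdeal, SetLike.mem_coe,
    Points.mem_toPrimeSpectrum_iff, Set.forall_mem_image]
  simp only [Points.mem_toPrimeSpectrum_iff]

theorem Points.closure_eq_of_vanishing {Z W : Set (Points K A)}
    (h : ∀ f : A, (∀ z ∈ Z, z.eval f = 0) ↔ ∀ w ∈ W, w.eval f = 0) : closure Z = closure W := by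
  ext x
  simp only [Points.mem_closure_iff, h]

/-- Hilbert's Nullstellensatz. -/
theorem Points.eq_zero_of_forall_eval_eq_zero [IsAlgClosed K] [IsDomain A] [Algebra.FiniteType K A]
    {f : A} (h : ∀ x : Points K A, x.eval f = 0) : f = 0 := by
  have hJ : IsJacobsonRing A := isJacobsonRing_of_finiteType (A := K)
  have hbot : Ideal.jacobson (⊥ : Ideal A) = ⊥ := by
    have := hJ.out (I := ⊥) (Ideal.isRadical_iff_quotient_reduced _ |>.mpr inferInstance)
    exact this
  rw [← Ideal.mem_bot, ← hbot, Ideal.jacobson, Ideal.mem_sInf]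
  rintro m ⟨-, hm⟩
  let _ : Field (A ⧸ m) := Ideal.Quotient.field m
  have : Module.Finite K (A ⧸ m) := finite_of_finite_type_of_isJacobsonRing K (A ⧸ m)
  let e : K ≃ₐ[K] A ⧸ m := AlgEquiv.ofBijective (Algebra.ofId K (A ⧸ m))
    IsAlgClosed.algebraMap_bijective_of_isIntegral
  let x : A →ₐ[K] K := (e.symm : A ⧸ m →ₐ[K] K).comp (Ideal.Quotient.mkₐ K m)
  have hx : e.symm (Ideal.Quotient.mk m f) = 0 := h x
  rw [map_eq_zero_iff e.symm e.symm.injective] at hx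
  exact Ideal.Quotient.eq_zero_iff_mem.mp hx

theorem Points.eq_zero_of_forall_mem_isOpen [IsAlgClosed K] [IsDomain A] [Algebra.FiniteType K A]
    {U : Set (Points K A)} (hU : IsOpen U) {x : Points K A} (hx : x ∈ U) {f : A}
    (hf : ∀ y ∈ U, y.eval f = 0) : f = 0 := by
  obtain ⟨V, hV, rfl⟩ := isOpen_induced_iff.mp hU
  obtain ⟨_, ⟨g, rfl⟩, hxg, hgV⟩ :=
    PrimeSpectrum.isTopologicalBasis_basic_opens.exists_subset_of_mem_open hx hV
  have hfg : f * g = 0 := Points.eq_zero_of_forall_eval_eq_zero (K := K) fun y => by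
    change y.toAlgHom (f * g) = 0
    rw [_root_.map_mul]
    by_cases hy : y.eval g = 0
    · exact mul_eq_zero_of_right _ hy
    · refine mul_eq_zero_of_left (hf y (hgV ?_)) _
      exact fun h => hy ((y.mem_toPrimeSpectrum_iff g).mp h)
  refine (mul_eq_zero.mp hfg).resolve_right ?_
  rintro rfl
  exact hxg (zero_mem _)

end ZariskiTopology

/-! ### Characters of the torus -/

section Characters

variable {K : Type*} [Field K] {n : ℕ}

theorem torusChar_zero (t : Fin n → Kˣ) : torusChar (0 : Fin n → ℤ) t = 1 := by simp [torusChar]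

theorem torusChar_add (a b : Fin n → ℤ) (t : Fin n → Kˣ) :
    torusChar (a + b) t = torusChar a t * torusChar b t := by
  simp [torusChar, zpow_add₀, Finset.prod_mul_distrib]

/-- The character `t ↦ t^m` as a homomorphism. -/
def torusCharHom (m : Fin n → ℤ) : (Fin n → Kˣ) →* K where
  toFun := torusChar m
  map_one' := by simp [torusChar]
  map_mul' s t := by simp [torusChar, mul_zpow, Finset.prod_mul_distrib]

theorem torusCharHom_injective [CharZero K] :
    Function.Injective (torusCharHom : (Fin n → ℤ) → ((Fin n → Kˣ) →* K)) := by
  intro a b h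
  ext i
  have h1 : ∀ m : Fin n → ℤ,
      torusChar m (Pi.mulSingle i (Units.mk0 (2 : K) two_ne_zero)) = 2 ^ m i := by
    intro m
    rw [torusChar, Finset.prod_eq_single i]
    · simp
    · intro k _ hk
      simp [Pi.mulSingle_eq_of_ne hk]
    · simp
  have h2 := DFunLike.congr_fun h (Pi.mulSingle i (Units.mk0 (2 : K) two_ne_zero))
  change torusChar a _ = torusChar b _ at h2
  rw [h1, h1] at h2
  have h3 : (2 : ℚ) ^ a i = 2 ^ b i := by
    apply Rat.cast_injective (α := K)
    push_cast
    exact h2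
  exact zpow_right_injective₀ (by norm_num) (by norm_num) h3

/-- Linear independence of characters, for coefficients in a vector space. -/
theorem eq_zero_of_sum_torusChar_smul_eq_zero [CharZero K] {V : Type*} [AddCommGroup V]
    [Module K V] {ι : Type*} (s : Finset ι) (w : ι → Fin n → ℤ) (hw : Function.Injective w)
    (c : ι → V) (h : ∀ t : Fin n → Kˣ, ∑ i ∈ s, torusChar (w i) t • c i = 0) {i : ι} (hi : i ∈ s) :
    c i = 0 := by
  rw [← Module.forall_dual_apply_eq_zero_iff K]
  intro l
  have hli := (linearIndependent_monoidHom (Fin n → Kˣ) K).comp (fun i => torusCharHom (w i))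
    (torusCharHom_injective.comp hw)
  refine linearIndependent_iff'.mp hli s (fun i => l (c i)) ?_ i hi
  ext t
  have := congrArg l (h t)
  rw [map_sum, map_zero] at this
  rw [Finset.sum_apply, Pi.zero_apply, ← this]
  refine Finset.sum_congr rfl fun i _ => ?_
  rw [map_smul, Pi.smul_apply, smul_eq_mul, smul_eq_mul, mul_comm]
  rfl

end Characters

/-! ### The weight decomposition -/

section Weights

variable {K A : Type*} [Field K] [CommRing A] [Algebra K A] {n : ℕ} (T : TorusAction K A n)

theorem TorusAction.one_mem_weightSpace : (1 : A) ∈ T.weightSpace 0 := fun t => by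
  rw [map_one, torusChar_zero, one_smul]

theorem TorusAction.mul_mem_weightSpace {a b : Fin n → ℤ} {f g : A} (hf : f ∈ T.weightSpace a)
    (hg : g ∈ T.weightSpace b) : f * g ∈ T.weightSpace (a + b) := fun t => by
  rw [map_mul, hf t, hg t, torusChar_add, smul_mul_smul_comm]

/-- The weight monoid `P` as a submonoid of `M`. -/
def TorusAction.weightMonoid [IsDomain A] : AddSubmonoid T.Lattice where
  carrier := T.weights
  zero_mem' := (Submodule.ne_bot_iff _).mpr ⟨1, T.one_mem_weightSpace, one_ne_zero⟩
  add_mem' {a b} ha hb := by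
    obtain ⟨f, hf, hf0⟩ := (Submodule.ne_bot_iff _).mp ha
    obtain ⟨g, hg, hg0⟩ := (Submodule.ne_bot_iff _).mp hb
    exact (Submodule.ne_bot_iff _).mpr ⟨f * g, T.mul_mem_weightSpace hf hg, mul_ne_zero hf0 hg0⟩

theorem TorusAction.closure_weights : AddSubgroup.closure T.weights = ⊤ :=
  AddSubgroup.closure_closure_coe_preimage

instance : Module.Finite ℤ T.Lattice :=
  inferInstanceAs (Module.Finite ℤ (AddSubgroup.toIntSubmodule
    (AddSubgroup.closure {m : Fin n → ℤ | T.weightSpace m ≠ ⊥})))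

instance : Module.Free ℤ T.Lattice :=
  inferInstanceAs (Module.Free ℤ (AddSubgroup.toIntSubmodule
    (AddSubgroup.closure {m : Fin n → ℤ | T.weightSpace m ≠ ⊥})))

/-- The components of a function with respect to the characters of the torus are homogeneous. -/
theorem TorusAction.exists_sum_weightSpace [CharZero K] (f : A) :
    ∃ c : (Fin n → ℤ) →₀ A, (∀ m ∈ c.support, c m ∈ T.weightSpace m) ∧ f = c.sum fun _ a => a := by
  obtain ⟨c, hc⟩ := T.regular f
  refine ⟨c, fun m hm s => ?_, ?_⟩
  · rw [← sub_eq_zero]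
    refine eq_zero_of_sum_torusChar_smul_eq_zero (K := K) c.support id Function.injective_id
      (fun m => T.comorphism s (c m) - torusChar m s • c m) (fun t => ?_) hm
    have h1 : T.comorphism s (T.comorphism t f) = T.comorphism (s * t) f := by
      rw [map_mul]; rfl
    rw [hc, hc, Finsupp.sum, Finsupp.sum, map_sum, ← sub_eq_zero, ← Finset.sum_sub_distrib] at h1
    rw [← h1]
    refine Finset.sum_congr rfl fun m _ => ?_
    rw [map_smul, smul_sub, smul_smul]
    congr 2
    rw [mul_comm]
    exact (map_mul (torusCharHom m) s t).symm
  · have h1 := hc 1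
    rw [map_one] at h1
    refine h1.trans (Finset.sum_congr rfl fun m _ => ?_)
    have h2 : torusChar m (1 : Fin n → Kˣ) = (1 : K) := map_one (torusCharHom m)
    simp only [h2, one_smul]

/-- The coordinate algebra of a toric variety is the semigroup algebra of its weight monoid; the
monomials are normalized to have the value `1` at a point of the open orbit. -/
theorem TorusAction.exists_algEquiv [IsAlgClosed K] [CharZero K] [IsDomain A]
    [Algebra.FiniteType K A] {x : Points K A} (hx : IsOpen (T.orbit x)) :
    ∃ j : AddMonoidAlgebra K T.weightMonoid ≃ₐ[K] A,
      (∀ m : T.weightMonoid, monomial j m ∈ T.weightSpace (m : T.Lattice)) ∧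
        ∀ m, x.eval (monomial j m) = 1 := by
  have hxx : x ∈ T.orbit x := ⟨1, by rw [map_one]; rfl⟩
  have hzero : ∀ (m : Fin n → ℤ) (f : A), f ∈ T.weightSpace m → x.eval f = 0 → f = 0 := by
    intro m f hf h0
    refine Points.eq_zero_of_forall_mem_isOpen hx hxx ?_
    rintro _ ⟨t, rfl⟩
    rw [Points.eval_map, hf t]
    change x.toAlgHom _ = 0
    rw [map_smul]
    exact smul_eq_zero_of_right _ h0
  have huniq : ∀ (m : Fin n → ℤ) (f g : A), f ∈ T.weightSpace m → g ∈ T.weightSpace m →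
      x.eval f = x.eval g → f = g := by
    intro m f g hf hg h
    rw [← sub_eq_zero]
    refine hzero m _ (sub_mem hf hg) ?_
    change x.toAlgHom _ = 0
    rw [map_sub, sub_eq_zero]
    exact h
  have hex : ∀ m : T.weightMonoid, ∃ f ∈ T.weightSpace (m : T.Lattice), x.eval f = 1 := by
    intro m
    obtain ⟨f, hf, hf0⟩ := (Submodule.ne_bot_iff _).mp m.2
    have h0 : x.eval f ≠ 0 := fun h => hf0 (hzero _ f hf h)
    refine ⟨(x.eval f)⁻¹ • f, Submodule.smul_mem _ _ hf, ?_⟩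
    change x.toAlgHom _ = 1
    rw [map_smul]
    exact inv_mul_cancel₀ h0
  choose χ hχ hχ1 using hex
  let g : Multiplicative T.weightMonoid →* A :=
    { toFun := fun m => χ m.toAdd
      map_one' := huniq 0 _ _ (hχ 0) T.one_mem_weightSpace ((hχ1 _).trans
        (_root_.map_one x.toAlgHom).symm)
      map_mul' := fun a b => by
        refine huniq _ _ _ (hχ _) (T.mul_mem_weightSpace (hχ _) (hχ _)) ((hχ1 _).trans ?_)
        exact ((_root_.map_mul x.toAlgHom _ _).trans
          (by rw [show x.toAlgHom (χ a.toAdd) = 1 from hχ1 _,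
            show x.toAlgHom (χ b.toAdd) = 1 from hχ1 _, one_mul])).symm }
  let L := AddMonoidAlgebra.lift K A T.weightMonoid g
  have hL : ∀ m (c : K), L (AddMonoidAlgebra.single m c) = c • χ m := by
    intro m c
    simp [L, g]
  have hinj : Function.Injective L := by
    rw [injective_iff_map_eq_zero]
    intro f hf
    rw [← AddMonoidAlgebra.sum_coeff_single f, Finsupp.sum, map_sum] at hf
    ext m
    by_contra hm
    refine hm (eq_zero_of_sum_torusChar_smul_eq_zero (K := K) f.coeff.support
      (fun m : T.weightMonoid => ((m : T.Lattice) : Fin n → ℤ))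
      (Subtype.val_injective.comp Subtype.val_injective) (fun m => f.coeff m) (fun t => ?_)
      (Finsupp.mem_support_iff.mpr hm))
    have h1 := congrArg (fun a => x.eval (T.comorphism t a)) hf
    simp only [map_sum, map_zero, hL, map_smul, hχ _ t] at h1
    change x.toAlgHom _ = x.toAlgHom 0 at h1
    rw [map_sum, map_zero] at h1
    rw [← h1]
    refine Finset.sum_congr rfl fun m _ => ?_
    rw [map_smul, map_smul, show x.toAlgHom (χ m) = 1 from hχ1 _]
    simp [mul_comm]
  have hsurj : Function.Surjective L := by
    rw [← AlgHom.range_eq_top, eq_top_iff]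
    intro f _
    obtain ⟨c, hc, rfl⟩ := T.exists_sum_weightSpace f
    refine sum_mem fun m hm => ?_
    have hm0 : T.weightSpace m ≠ ⊥ :=
      (Submodule.ne_bot_iff _).mpr ⟨c m, hc m hm, Finsupp.mem_support_iff.mp hm⟩
    let m' : T.weightMonoid := ⟨⟨m, AddSubgroup.subset_closure hm0⟩, hm0⟩
    refine ⟨AddMonoidAlgebra.single m' (x.eval (c m)), ?_⟩
    change L _ = _
    rw [hL]
    refine huniq m _ _ (Submodule.smul_mem _ _ (hχ m')) (hc m hm) ?_
    change x.toAlgHom _ = _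
    rw [map_smul, show x.toAlgHom (χ m') = 1 from hχ1 _]
    simp
  refine ⟨AlgEquiv.ofBijective L ⟨hinj, hsurj⟩, fun m => ?_, fun m => ?_⟩
  · have h1 : monomial (AlgEquiv.ofBijective L ⟨hinj, hsurj⟩) m = χ m :=
      (hL m 1).trans (one_smul _ _)
    rw [h1]
    exact hχ m
  · have h1 : monomial (AlgEquiv.ofBijective L ⟨hinj, hsurj⟩) m = χ m :=
      (hL m 1).trans (one_smul _ _)
    rw [h1]
    exact hχ1 m

end Weights

/-! ### The weight monoid and supports of points -/

section WeightMonoid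

variable {K A M : Type*} [Field K] [CommRing A] [Algebra K A] [AddCommGroup M] {P : AddSubmonoid M}
  (j : AddMonoidAlgebra K P ≃ₐ[K] A)

theorem fg_of_algEquiv [Algebra.FiniteType K A] (j : AddMonoidAlgebra K P ≃ₐ[K] A) : P.FG := by
  have : Algebra.FiniteType K (AddMonoidAlgebra K P) :=
    Algebra.FiniteType.equiv inferInstance j.symm
  rw [← AddMonoid.fg_iff_addSubmonoid_fg]
  exact AddMonoidAlgebra.fg_of_finiteType (R := K)

theorem exists_add_mem_of_closure_eq_top (hgen : AddSubgroup.closure (P : Set M) = ⊤) (m : M) :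
    ∃ b ∈ P, m + b ∈ P := by
  have hm : m ∈ AddSubgroup.closure (P : Set M) := hgen ▸ AddSubgroup.mem_top m
  induction hm using AddSubgroup.closure_induction with
  | mem m hm => exact ⟨0, P.zero_mem, by rwa [add_zero]⟩
  | zero => exact ⟨0, P.zero_mem, by rw [add_zero]; exact P.zero_mem⟩
  | add a b _ _ iha ihb =>
    obtain ⟨c, hc, hac⟩ := iha
    obtain ⟨d, hd, hbd⟩ := ihb
    exact ⟨c + d, add_mem hc hd, by rw [add_add_add_comm]; exact add_mem hac hbd⟩
  | neg a _ ih =>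
    obtain ⟨c, hc, hac⟩ := ih
    exact ⟨a + c, hac, by rwa [neg_add_cancel_left]⟩

theorem monomial_nsmul (k : ℕ) (m : P) : monomial j (k • m) = monomial j m ^ k := by
  induction k with
  | zero => rw [zero_smul, monomial_zero, pow_zero]
  | succ k ih => rw [succ_nsmul, monomial_add, ih, pow_succ]

/-- The weight monoid of a normal algebra is saturated: the quotient of monomials `χ^(m + b) / χ^b`
is integral if `k m` is in `P`. -/
theorem mem_of_nsmul_mem [IsDomain A] [IsIntegrallyClosed A] (j : AddMonoidAlgebra K P ≃ₐ[K] A)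
    (hgen : AddSubgroup.closure (P : Set M) = ⊤) (m : M) (k : ℕ) (hk : 0 < k) (h : k • m ∈ P) :
    m ∈ P := by
  obtain ⟨b, hb, hmb⟩ := exists_add_mem_of_closure_eq_top hgen m
  obtain ⟨f, hf⟩ : monomial j ⟨b, hb⟩ ∣ monomial j ⟨m + b, hmb⟩ := by
    rw [← IsIntegrallyClosed.pow_dvd_pow_iff hk.ne', ← monomial_nsmul, ← monomial_nsmul]
    refine ⟨monomial j ⟨k • m, h⟩, ?_⟩
    rw [← monomial_add]
    congr 1
    apply Subtype.ext
    change k • (m + b) = k • b + k • m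
    rw [smul_add, add_comm]
  apply mem_of_coeffAt_ne_zero j (f := f)
  rw [← coeffAt_monomial_mul j ⟨b, hb⟩, ← hf, coeffAt_monomial, if_pos (add_comm m b)]
  exact one_ne_zero

/-- The set of weights of monomials that do not vanish at a point. -/
def pointSupport (y : Points K A) : AddSubmonoid M where
  carrier := {m | ∃ h : m ∈ P, y.eval (monomial j ⟨m, h⟩) ≠ 0}
  zero_mem' := ⟨P.zero_mem, by
    rw [show monomial j ⟨0, P.zero_mem⟩ = 1 from monomial_zero j]
    change y.toAlgHom 1 ≠ 0
    rw [map_one]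
    exact one_ne_zero⟩
  add_mem' {a b} := fun ⟨ha, ha0⟩ ⟨hb, hb0⟩ => ⟨add_mem ha hb, by
    rw [show monomial j ⟨a + b, add_mem ha hb⟩ = _ from monomial_add j ⟨a, ha⟩ ⟨b, hb⟩]
    change y.toAlgHom _ ≠ 0
    rw [map_mul]
    exact mul_ne_zero ha0 hb0⟩

theorem mem_pointSupport_iff {y : Points K A} (m : P) :
    (m : M) ∈ pointSupport j y ↔ y.eval (monomial j m) ≠ 0 :=
  ⟨fun ⟨_, h⟩ => h, fun h => ⟨m.2, h⟩⟩

theorem pointSupport_le (y : Points K A) : pointSupport j y ≤ P := fun _ h => h.1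

theorem pointSupport_face (y : Points K A) :
    ∀ a ∈ P, ∀ b ∈ P, a + b ∈ pointSupport j y → a ∈ pointSupport j y := by
  rintro a ha b hb hab
  refine ⟨ha, fun h => hab.2 ?_⟩
  rw [show monomial j ⟨a + b, add_mem ha hb⟩ = _ from monomial_add j ⟨a, ha⟩ ⟨b, hb⟩]
  change y.toAlgHom _ = 0
  rw [map_mul]
  exact mul_eq_zero_of_left h _

/-- A face of a monoid is determined by the generators of the monoid it contains. -/
theorem le_of_inter_generators_le {G : Set M} (hG : AddSubmonoid.closure G = P)
    {S S' : AddSubmonoid M} (hS'P : S' ≤ P) (hS' : ∀ a ∈ P, ∀ b ∈ P, a + b ∈ S' → a ∈ S')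
    (h : ∀ g ∈ G, g ∈ S' → g ∈ S) : S' ≤ S := by
  intro m hmS
  have hm : m ∈ AddSubmonoid.closure G := hG ▸ hS'P hmS
  induction hm using AddSubmonoid.closure_induction with
  | mem g hg => exact h g hg hmS
  | zero => exact S.zero_mem
  | add a b ha hb iha ihb =>
    rw [hG] at ha hb
    exact S.add_mem (iha (hS' a ha b hb hmS)) (ihb (hS' b hb a ha (by rwa [add_comm])))

/-- The elements of `P` in a face of the cone spanned by `P`. -/
def faceMonoid (P : AddSubmonoid M) (τ : PointedCone ℚ (ℚ ⊗[ℤ] M)) : AddSubmonoid M where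
  carrier := {m | m ∈ P ∧ (1 : ℚ) ⊗ₜ[ℤ] m ∈ τ}
  zero_mem' := ⟨P.zero_mem, by rw [tmul_zero]; exact zero_mem _⟩
  add_mem' {a b} ha hb := ⟨add_mem ha.1 hb.1, by rw [tmul_add]; exact add_mem ha.2 hb.2⟩

theorem faceMonoid_face {τ : PointedCone ℚ (ℚ ⊗[ℤ] M)} (hτ : τ.IsFaceOf (weightCone (P : Set M))) :
    ∀ a ∈ P, ∀ b ∈ P, a + b ∈ faceMonoid P τ → a ∈ faceMonoid P τ := by
  rintro a ha b hb ⟨-, h⟩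
  rw [tmul_add, hτ.add_mem_iff_mem (tmul_mem_weightCone ha) (tmul_mem_weightCone hb)] at h
  exact ⟨ha, h.1⟩

theorem mem_faceMonoid_iff {τ : PointedCone ℚ (ℚ ⊗[ℤ] M)} {m : M} (hm : m ∈ P) :
    m ∈ faceMonoid P τ ↔ (1 : ℚ) ⊗ₜ[ℤ] m ∈ τ := ⟨fun h => h.2, fun h => ⟨hm, h⟩⟩

end WeightMonoid

/-! ### Torus orbits -/

section TorusOrbits

variable {K A : Type*} [Field K] [CommRing A] [Algebra K A] {n : ℕ} {T : TorusAction K A n}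

theorem mem_orbit_self (y : Points K A) : y ∈ T.orbit y := ⟨1, by rw [map_one]; rfl⟩

theorem orbit_eq_of_mem {y w : Points K A} (hw : w ∈ T.orbit y) : T.orbit w = T.orbit y := by
  obtain ⟨t, rfl⟩ := hw
  ext z
  constructor
  · rintro ⟨s, rfl⟩
    exact ⟨t * s, by rw [map_mul]; rfl⟩
  · rintro ⟨s, rfl⟩
    exact ⟨t⁻¹ * s, by rw [Points.map_map, ← map_mul, mul_inv_cancel_left]⟩

theorem mem_faceOrbit_of_mem_orbit {τ : PointedCone ℚ (ℚ ⊗[ℤ] T.Lattice)} {y w : Points K A}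
    (hy : y ∈ T.faceOrbit τ) (hw : w ∈ T.orbit y) : w ∈ T.faceOrbit τ := by
  intro f
  rw [orbit_eq_of_mem hw]
  exact hy f

variable [IsDomain A] {j : AddMonoidAlgebra K T.weightMonoid ≃ₐ[K] A}

theorem coeffAt_comorphism (hj : ∀ m : T.weightMonoid, monomial j m ∈ T.weightSpace (m : T.Lattice))
    (u : T.Lattice) (t : Fin n → Kˣ) (f : A) :
    coeffAt j u (T.comorphism t f) = torusChar (u : Fin n → ℤ) t * coeffAt j u f := by
  have : coeffAt j u ∘ₗ (T.comorphism t : A →ₐ[K] A).toLinearMap =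
      torusChar (u : Fin n → ℤ) t • coeffAt j u := linearMap_ext_monomial j fun m => by
    change coeffAt j u (T.comorphism t (monomial j m)) = _ * coeffAt j u (monomial j m)
    rw [hj m t, map_smul, coeffAt_monomial, smul_eq_mul]
    split_ifs with h
    · rw [h]
    · rw [mul_zero, mul_zero]
  exact LinearMap.congr_fun this f

theorem coeffAt_eq_zero_of_mem_weightSpace [CharZero K]
    (hj : ∀ m : T.weightMonoid, monomial j m ∈ T.weightSpace (m : T.Lattice))
    {m u : T.Lattice} (hmu : u ≠ m) {f : A} (hf : f ∈ T.weightSpace (m : Fin n → ℤ)) :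
    coeffAt j u f = 0 := by
  by_contra h0
  refine hmu (Subtype.ext (torusCharHom_injective (K := K) (MonoidHom.ext fun t => ?_)))
  have h1 := coeffAt_comorphism hj u t f
  rw [hf t, map_smul, smul_eq_mul] at h1
  exact (mul_right_cancel₀ h0 h1).symm

/-- The subspace `I_τ` consists of the functions without monomials with weight in `τ`. -/
theorem mem_faceIdeal_iff [CharZero K]
    (hj : ∀ m : T.weightMonoid, monomial j m ∈ T.weightSpace (m : T.Lattice))
    (τ : PointedCone ℚ (ℚ ⊗[ℤ] T.Lattice)) (f : A) :
    f ∈ T.faceIdeal τ ↔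
      ∀ m : T.weightMonoid, (1 : ℚ) ⊗ₜ[ℤ] (m : T.Lattice) ∈ τ → coeffAt j m f = 0 := by
  constructor
  · intro hf m hm
    have hle : T.faceIdeal τ ≤ LinearMap.ker (coeffAt j (m : T.Lattice)) := by
      refine iSup₂_le fun u hu g hg => coeffAt_eq_zero_of_mem_weightSpace hj ?_ hg
      rintro rfl
      exact hu.2 hm
    exact hle hf
  · intro h
    refine mem_of_monomial_mem j _ f fun m hm => ?_
    exact (le_iSup₂_of_le (m : T.Lattice) ⟨m.2, fun h' => hm (h m h')⟩ le_rfl :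
      T.weightSpace (m : T.Lattice) ≤ T.faceIdeal τ) (hj m)

theorem forall_orbit_eval_eq_zero_iff [CharZero K]
    (hj : ∀ m : T.weightMonoid, monomial j m ∈ T.weightSpace (m : T.Lattice)) (y : Points K A)
    (f : A) : (∀ z ∈ T.orbit y, z.eval f = 0) ↔
      ∀ m : T.weightMonoid, coeffAt j m f * y.eval (monomial j m) = 0 := by
  have hval : ∀ t, (y.map (T.comorphism t)).eval f = ∑ m ∈ (j.symm f).coeff.support,
      torusChar ((m : T.Lattice) : Fin n → ℤ) t •
        (coeffAt j m f * y.eval (monomial j m)) := by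
    intro t
    rw [Points.eval_map]
    conv_lhs => rw [eq_sum_monomial j f, map_sum]
    change y.toAlgHom _ = _
    rw [map_sum]
    refine Finset.sum_congr rfl fun m _ => ?_
    rw [map_smul, hj m t, map_smul, map_smul, smul_eq_mul, smul_eq_mul, smul_eq_mul,
      mul_left_comm]
    rfl
  constructor
  · intro h m
    by_cases hm : m ∈ (j.symm f).coeff.support
    · refine eq_zero_of_sum_torusChar_smul_eq_zero (K := K) (j.symm f).coeff.support
        (fun m : T.weightMonoid => ((m : T.Lattice) : Fin n → ℤ))
        (Subtype.val_injective.comp Subtype.val_injective)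
        (fun m => coeffAt j m f * y.eval (monomial j m)) (fun t => ?_) hm
      rw [← hval]
      exact h _ ⟨t, rfl⟩
    · rw [coeffAt_coe, Finsupp.notMem_support_iff.mp hm, zero_mul]
  · rintro h _ ⟨t, rfl⟩
    rw [hval]
    exact Finset.sum_eq_zero fun m _ => by rw [h, smul_zero]

theorem mem_faceOrbit [CharZero K]
    (hj : ∀ m : T.weightMonoid, monomial j m ∈ T.weightSpace (m : T.Lattice)) {y : Points K A}
    {τ : PointedCone ℚ (ℚ ⊗[ℤ] T.Lattice)}
    (h : ∀ m : T.weightMonoid, y.eval (monomial j m) ≠ 0 ↔ (1 : ℚ) ⊗ₜ[ℤ] (m : T.Lattice) ∈ τ) :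
    y ∈ T.faceOrbit τ := by
  intro f
  rw [forall_orbit_eval_eq_zero_iff hj, mem_faceIdeal_iff hj]
  refine forall_congr' fun m => ?_
  rw [← h m, mul_eq_zero, or_iff_not_imp_right]

end TorusOrbits

/-! ### Orbits of the neutral component -/

section NeutralComponent

variable {K A : Type u} [Field K] [IsAlgClosed K] [CommRing A] [Algebra K A]

theorem mem_autZeroOrbit_self (x : Points K A) : x ∈ autZeroOrbit x := ⟨1, one_mem _, rfl⟩

theorem autZeroOrbit_eq_of_mem {x y : Points K A} (hy : y ∈ autZeroOrbit x) :
    autZeroOrbit y = autZeroOrbit x := by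
  obtain ⟨φ, hφ, rfl⟩ := hy
  ext z
  constructor
  · rintro ⟨ψ, hψ, rfl⟩
    exact ⟨φ * ψ, mul_mem hφ hψ, rfl⟩
  · rintro ⟨ψ, hψ, rfl⟩
    exact ⟨φ⁻¹ * ψ, mul_mem (inv_mem hφ) hψ, by rw [Points.map_map, mul_inv_cancel_left]⟩

variable [IsDomain A] [Algebra.FiniteType K A] {n : ℕ} {T : TorusAction K A n}
  {j : AddMonoidAlgebra K T.weightMonoid ≃ₐ[K] A}

/-- The torus is connected: its automorphisms form the family `χ^m ↦ t^m χ^m` over the spectrum of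
the group algebra of `ℤⁿ`. -/
theorem comorphism_mem_autZero
    (hj : ∀ m : T.weightMonoid, monomial j m ∈ T.weightSpace (m : T.Lattice)) (t : Fin n → Kˣ) :
    T.comorphism t ∈ autZero K A := by
  let w : T.weightMonoid → Fin n → ℤ := fun m => (m : T.Lattice)
  let Φ : A →ₐ[K] AddMonoidAlgebra K (Fin n → ℤ) ⊗[K] A := liftMonomial j
    { toFun := fun m => AddMonoidAlgebra.single (w m.toAdd) 1 ⊗ₜ monomial j m.toAdd
      map_one' := by
        rw [show (Multiplicative.toAdd (1 : Multiplicative T.weightMonoid)) = 0 from rfl,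
          monomial_zero]
        rfl
      map_mul' := fun a b => by
        rw [Algebra.TensorProduct.tmul_mul_tmul, AddMonoidAlgebra.single_mul_single, mul_one,
          ← monomial_add]
        rfl }
  have hΦ : ∀ (r : AddMonoidAlgebra K (Fin n → ℤ) →ₐ[K] K) (m : T.weightMonoid),
      specialize A r (Φ (monomial j m)) = r (AddMonoidAlgebra.single (w m) 1) • monomial j m := by
    intro r m
    rw [liftMonomial_monomial]
    exact specialize_tmul _ _ _
  let r : (Fin n → Kˣ) → AddMonoidAlgebra K (Fin n → ℤ) →ₐ[K] K := fun s =>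
    AddMonoidAlgebra.lift K K (Fin n → ℤ)
      { toFun := fun m => torusChar m.toAdd s
        map_one' := torusChar_zero s
        map_mul' := fun a b => torusChar_add _ _ s }
  have hr : ∀ s m, r s (AddMonoidAlgebra.single m 1) = torusChar m s := by
    intro s m
    simp [r]
  have hval : ∀ s f, specialize A (r s) (Φ f) = T.comorphism s f := by
    intro s f
    have : ((specialize A (r s)).comp Φ).toLinearMap =
        (T.comorphism s : A →ₐ[K] A).toLinearMap := linearMap_ext_monomial j fun m => by
      change specialize A (r s) (Φ (monomial j m)) = T.comorphism s (monomial j m)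
      rw [hΦ, hr, hj m s]
    exact LinearMap.congr_fun this f
  refine mem_autZero_of_family Φ (fun s => ?_) (r 1) (r t) (fun f => ?_) (hval t)
  · rw [← AlgHom.range_eq_top, eq_top_iff]
    intro f _
    refine mem_of_monomial_mem j ((specialize A s).comp Φ).range.toSubmodule f fun m _ => ?_
    -- The coordinate functions on the torus are units, so their values do not vanish.
    refine ⟨s (AddMonoidAlgebra.single (-w m) 1) • monomial j m, ?_⟩
    change (specialize A s).comp Φ _ = _
    rw [map_smul, AlgHom.comp_apply, hΦ, smul_smul, ← map_mul, AddMonoidAlgebra.single_mul_single,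
      neg_add_cancel, mul_one, ← AddMonoidAlgebra.one_def, map_one, one_smul]
  · rw [hval, map_one]
    rfl

theorem orbit_subset_autZeroOrbit
    (hj : ∀ m : T.weightMonoid, monomial j m ∈ T.weightSpace (m : T.Lattice)) (y : Points K A) :
    T.orbit y ⊆ autZeroOrbit y := by
  rintro _ ⟨t, rfl⟩
  exact ⟨_, comorphism_mem_autZero hj t, rfl⟩

variable [IsIntegrallyClosed A]

/-- If the face `τ` admits no roots, then `I_τ` is an invariant ideal of `Aut(X)⁰`, and the orbits
of `Aut(X)⁰` on `O_τ` are dense in the closure of `O_τ`. -/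
theorem closure_autZeroOrbit_eq [CharZero K]
    (hj : ∀ m : T.weightMonoid, monomial j m ∈ T.weightSpace (m : T.Lattice))
    {τ : PointedCone ℚ (ℚ ⊗[ℤ] T.Lattice)} (hτ : τ.IsFaceOf T.cone)
    (hroot : ∀ e : T.Lattice, ¬ IsFaceRoot T.weights τ e) {y : Points K A}
    (hy : y ∈ T.faceOrbit τ) : closure (autZeroOrbit y) = closure (T.faceOrbit τ) := by
  have hS := faceMonoid_face (P := T.weightMonoid) hτ
  have hI : ∀ f : A, f ∈ RingHom.ker (truncation j (faceMonoid T.weightMonoid τ) hS) ↔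
      f ∈ T.faceIdeal τ := by
    intro f
    rw [mem_ker_truncation_iff, mem_faceIdeal_iff hj]
    exact forall_congr' fun m => by rw [mem_faceMonoid_iff m.2]
  refine Points.closure_eq_of_vanishing fun f => ⟨fun h w hw => ?_, fun h => ?_⟩
  · have hf : f ∈ T.faceIdeal τ :=
      (hy f).mp fun z hz => h z (orbit_subset_autZeroOrbit hj y hz)
    exact (hw f).mpr hf w (mem_orbit_self w)
  · have hf : f ∈ T.faceIdeal τ :=
      (hy f).mp fun z hz => h z (mem_faceOrbit_of_mem_orbit hy hz)
    rintro _ ⟨φ, hφ, rfl⟩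
    have hφf := apply_mem_of_mem_autZero hφ (fun D g hg =>
      derivation_mem_ker_truncation j hS (fg_of_algEquiv j) T.closure_weights
        (mem_of_nsmul_mem j T.closure_weights) hτ (fun m hm => mem_faceMonoid_iff hm) hroot D hg)
      ((hI f).mpr hf)
    exact (hy _).mpr ((hI _).mp hφf) y (mem_orbit_self y)

/-- If the face spanned by the support of a point admits a root, then a root automorphism moves the
point to a point with larger support. -/
theorem exists_pointSupport_lt {e : T.Lattice} {y : Points K A}
    (he : IsFaceRoot T.weights (weightCone (pointSupport j y : Set T.Lattice)) e) :
    ∃ z ∈ autZeroOrbit y, pointSupport j y < pointSupport j z := by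
  have hgen := T.closure_weights
  have hface := isFaceOf_weightCone (pointSupport_le j y) (pointSupport_face j y)
  obtain ⟨p, hpe, hpτ, m, hm, hpm, hme, hmeτ⟩ :=
    IsFaceRoot.exists_add_mem_face (P := T.weightMonoid) (fg_of_algEquiv j) hgen
      (mem_of_nsmul_mem j hgen) hface he
  have hp0 : ∀ u ∈ pointSupport j y, p u = 0 := by
    intro u hu
    have := hpτ.2 _ (tmul_mem_weightCone hu)
    rw [latticeToDual_tmul, one_mul] at this
    exact_mod_cast this
  obtain ⟨φ, hφ, hφ0, hφ1⟩ := exists_root_automorphism j (p := p) (e := e)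
    (fun m hm => hpe.1.nonneg hm) hpe.2.1
    (fun m hm hpm => hpe.add_mem (fg_of_algEquiv j) hgen (mem_of_nsmul_mem j hgen) hm hpm)
  have hmy : m ∉ pointSupport j y := fun h => by
    have := hp0 m h
    omega
  refine ⟨y.map φ, ⟨φ, hφ, rfl⟩, lt_of_le_of_ne (fun u hu => ?_) fun h => hmy ?_⟩
  · refine ⟨hu.1, ?_⟩
    rw [Points.eval_map, hφ0 ⟨u, hu.1⟩ (hp0 u hu)]
    exact hu.2
  · rw [h]
    refine ⟨hm, ?_⟩
    have h0 : y.eval (monomial j ⟨m, hm⟩) = 0 := by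
      by_contra h0
      exact hmy ⟨hm, h0⟩
    have h1 : y.eval (monomial j ⟨m + e, hme⟩) ≠ 0 := by
      rw [← mem_pointSupport_iff]
      exact (tmul_mem_weightCone_iff_of_face (pointSupport_face j y) hme).mp hmeτ
    rw [Points.eval_map, hφ1 ⟨m, hm⟩ hpm]
    change y.toAlgHom _ ≠ 0
    rw [map_add]
    change y.eval _ + y.eval _ ≠ 0
    rwa [h0, zero_add]

/-- Every orbit of `Aut(X)⁰` contains a point whose support spans a face without roots: a point with
maximal support. -/
theorem exists_pointSupport_not_isFaceRoot (x : Points K A) :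
    ∃ y ∈ autZeroOrbit x,
      ∀ e, ¬ IsFaceRoot T.weights (weightCone (pointSupport j y : Set T.Lattice)) e := by
  obtain ⟨G, hG⟩ := fg_of_algEquiv j
  obtain ⟨y, hy, hmax⟩ := Set.Finite.exists_maximalFor'
    (fun z : Points K A => (G : Set T.Lattice) ∩ pointSupport j z) (autZeroOrbit x)
    (G.finite_toSet.finite_subsets.subset (by rintro _ ⟨z, -, rfl⟩; exact Set.inter_subset_left))
    ⟨x, mem_autZeroOrbit_self x⟩
  refine ⟨y, hy, fun e he => ?_⟩
  obtain ⟨z, hz, hyz⟩ := exists_pointSupport_lt he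
  rw [autZeroOrbit_eq_of_mem hy] at hz
  have hle := hmax hz (Set.inter_subset_inter_right _ hyz.le)
  exact hyz.not_ge (le_of_inter_generators_le hG (pointSupport_le j z) (pointSupport_face j z)
    fun g hg hgz => (hle ⟨hg, hgz⟩).2)

end NeutralComponent

end ToricOrbits

end

/-! ### Closures of orbits -/

theorem corollary5 {K A : Type u} [Field K] [IsAlgClosed K] [CharZero K]
    [CommRing A] [IsDomain A] [Algebra K A] [Algebra.FiniteType K A] [IsIntegrallyClosed A]
    {n : ℕ} (T : ToricOrbits.TorusAction K A n)
    (hT : ∃ x : ToricOrbits.Points K A, IsOpen (T.orbit x)) :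
    (∀ x : ToricOrbits.Points K A, ∃ τ : PointedCone ℚ (ℚ ⊗[ℤ] T.Lattice),
      τ.IsFaceOf T.cone ∧ (∀ e : T.Lattice, ¬ ToricOrbits.IsFaceRoot T.weights τ e) ∧
        closure (ToricOrbits.autZeroOrbit x) = closure (T.faceOrbit τ)) ∧
    (∀ τ : PointedCone ℚ (ℚ ⊗[ℤ] T.Lattice),
      τ.IsFaceOf T.cone → (∀ e : T.Lattice, ¬ ToricOrbits.IsFaceRoot T.weights τ e) →
        ∃ x : ToricOrbits.Points K A,
          closure (ToricOrbits.autZeroOrbit x) = closure (T.faceOrbit τ)) := by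
  classical
  obtain ⟨x₀, hx₀⟩ := hT
  obtain ⟨j, hj, hj1⟩ := T.exists_algEquiv hx₀
  refine ⟨fun x => ?_, fun τ hτ hroot => ?_⟩
  · obtain ⟨y, hy, hroot⟩ := ToricOrbits.exists_pointSupport_not_isFaceRoot (T := T) (j := j) x
    have hface := ToricOrbits.pointSupport_face j y
    have hτ := ToricOrbits.isFaceOf_weightCone (ToricOrbits.pointSupport_le j y) hface
    refine ⟨_, hτ, hroot, ?_⟩
    rw [← ToricOrbits.autZeroOrbit_eq_of_mem hy]
    refine ToricOrbits.closure_autZeroOrbit_eq hj hτ hroot (ToricOrbits.mem_faceOrbit hj fun m => ?_)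
    rw [ToricOrbits.tmul_mem_weightCone_iff_of_face hface m.2, ToricOrbits.mem_pointSupport_iff]
  · -- The composite of the truncation with the base point of the open orbit lies in `O_τ`.
    have hS := ToricOrbits.faceMonoid_face (P := T.weightMonoid) hτ
    let y : ToricOrbits.Points K A := x₀.toAlgHom.comp (ToricOrbits.truncation j _ hS)
    refine ⟨y, ToricOrbits.closure_autZeroOrbit_eq hj hτ hroot
      (ToricOrbits.mem_faceOrbit hj fun m => ?_)⟩
    have hy : y.eval (ToricOrbits.monomial j m) =
        x₀.toAlgHom (ToricOrbits.truncation j _ hS (ToricOrbits.monomial j m)) := rfl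
    rw [hy, ToricOrbits.truncation_monomial, ← ToricOrbits.mem_faceMonoid_iff m.2]
    split_ifs with h
    · exact iff_of_true ((hj1 m).trans_ne one_ne_zero) h
    · rw [map_zero]
      exact iff_of_false (fun h' => h' rfl) h
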